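/- Conventions. Rings are unital and not assumed commutative. Let $R$ be a ring whose additive group is finitely generated and torsion-free; put $\mathbb{Q}R=\mathbb{Q}\otimes_{\mathbb{Z}}R\supseteq R$, let $R^\times$ be the monoid of left regular elements of $R$ (those $a$ with $x\mapsto ax$ injective on $R$), and let $\mathcal{O}=\mathcal O_R$ be the set of elements of $\mathbb{Q}R$ that are integral over $\mathbb{Z}$. We have $R^\times\subseteq(\mathbb{Q}R)^*$. For a submonoid $M\subseteq R^\times$ let $\langle M\rangle\subseteq(\mathbb{Q}R)^*$ be the subgroup generated by $M$, and $\widetilde M=\langle M\rangle\cap\mathcal{O}$. Let $M$ be Abelian and let $\mathcal{L}\subseteq\mathbb{Q}R$ be an $M$-invariant additive subgroup of full rank (i.e. $\mathbb{Q}\mathcal{L}=\mathbb{Q}R$). Write $M\curvearrowright\mathcal{L}$ for the action by left multiplication. Two such actions $M_i\curvearrowright\mathcal{L}_i$ are isomorphic if there are a monoid isomorphism $\mathfrak{t}\colon M_1\to M_2$ and a group isomorphism $\mathfrak{b}\colon\mathcal{L}_1\to\mathcal{L}_2$ with $\mathfrak{b}(ax)=\mathfrak{t}(a)\mathfrak{b}(x)$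 for all $a\in M_1$, $x\in\mathcal{L}_1$. Let $\mathcal{C}$ be the smallest family of subgroups of $\mathcal{L}$ that contains $\mathcal{L}$ and is closed under taking images and preimages under $x\mapsto ax$ ($a\in M$), and let $\overline{\mathcal{L}}=\varprojlim_{C\in\mathcal{C}}\mathcal{L}/C$. Put $M^{-1}\mathcal{L}=\bigcup_{a\in M}a^{-1}\mathcal{L}$. The group $M^{-1}\mathcal{L}\rtimes\langle M\rangle$ acts by $(z,\gamma).x=z+\gamma x$, which gives a partial action on $\mathcal{L}$ by the bijections $\mathcal{L}\cap g^{-1}.\mathcal{L}\to g.\mathcal{L}\cap\mathcal{L}$; it extends uniquely to a partial action on $\overline{\mathcal{L}}$ by homeomorphisms between clopen sets (the graph of $g$ on $\overline{\mathcal L}$ is the closure of its graph on $\mathcal{L}$). Let $(M^{-1}\mathcal{L}\rtimes\langle M\rangle)\ltimes\overline{\mathcal{L}}$ be the associated partial transformation groupoid, i.e. the set of pairs $(g,\boldsymbol{x})$ with $\boldsymbol{x}$ in the domain of $g$, topologized as a subspace of the product of the discrete group with $\overline{\mathcal{L}}$. Theorem. For $i=1,2$, let $R_i$ be a ring whose additive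 group is finitely generated and torsion-free, $M_i\subseteq R_i^\times$ an Abelian submonoid such that $\mathrm{span}_{\mathbb{Z}}(M_i)$ has finite index in $R_i$, and $\mathcal{L}_i\subseteq\mathbb{Q}R_i$ an $M_i$-invariant full rank subgroup (for instance, one contained in $R_i$). Assume that for each $i$ there is $a\in M_i$ such that $x\mapsto(1-a)x$ is injective on $\mathcal{L}_i$. (1) If $(M_1^{-1}\mathcal{L}_1\rtimes\langle M_1\rangle)\ltimes\overline{\mathcal{L}}_1$ and $(M_2^{-1}\mathcal{L}_2\rtimes\langle M_2\rangle)\ltimes\overline{\mathcal{L}}_2$ are isomorphic as topological groupoids, then there are $\mathbb{Q}$-algebra isomorphisms $\varphi_1\colon\mathbb{Q}R_1\to\mathbb{Q}R_2$ and $\varphi_2\colon\mathbb{Q}R_2\to\mathbb{Q}R_1$ with $\varphi_1(M_1)\subseteq\widetilde{M_2}$ and $\varphi_2(M_2)\subseteq\widetilde{M_1}$. (2) Suppose in addition that (N) $M_i=\widetilde{M_i}$ for $i=1,2$, and (S) for every $\mathbb{Q}$-algebra automorphism $\psi$ of $\mathbb{Q}R_1$, $\psi(M_1)\subseteq M_1$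 implies $\psi(M_1)=M_1$, and that either $\mathcal{L}_i=\mathrm{span}_{\mathbb{Z}}(M_i)=R_i$ for both $i$, or $\mathcal{L}_i=\mathcal{O}_{R_i}$ for both $i$. Then the algebraic actions $M_1\curvearrowright\mathcal{L}_1$ and $M_2\curvearrowright\mathcal{L}_2$ are isomorphic if and only if the groupoids $(M_i^{-1}\mathcal{L}_i\rtimes\langle M_i\rangle)\ltimes\overline{\mathcal{L}}_i$, $i=1,2$, are isomorphic as topological groupoids. -/

import Mathlib

open scoped TensorProduct

/-! ### Topological groupoids -/

/-- A topological groupoid: spaces of objects (units) and arrows, source and target maps, and a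
multiplication `mul a b` defined when `src a = tgt b`. -/
structure TopGroupoid where
  Obj : Type*
  Arr : Type*
  [topObj : TopologicalSpace Obj]
  [topArr : TopologicalSpace Arr]
  src : Arr → Obj
  tgt : Arr → Obj
  one : Obj → Arr
  inv : Arr → Arr
  mul : ∀ a b : Arr, src a = tgt b → Arr
  src_one : ∀ x, src (one x) = x
  tgt_one : ∀ x, tgt (one x) = x
  src_inv : ∀ a, src (inv a) = tgt a
  tgt_inv : ∀ a, tgt (inv a) = src a
  src_mul : ∀ a b h, src (mul a b h) = src b
  tgt_mul : ∀ a b h, tgt (mul a b h) = tgt a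
  mul_one : ∀ a, mul a (one (src a)) (tgt_one _).symm = a
  one_mul : ∀ a, mul (one (tgt a)) a (src_one _) = a
  mul_assoc : ∀ a b c (h : src a = tgt b) (h' : src b = tgt c),
    mul (mul a b h) c ((src_mul a b h).trans h') = mul a (mul b c h') (h.trans (tgt_mul b c h').symm)
  inv_mul : ∀ a, mul (inv a) a (src_inv a) = one (src a)
  mul_inv : ∀ a, mul a (inv a) (tgt_inv a).symm = one (tgt a)
  continuous_src : Continuous src
  continuous_tgt : Continuous tgt
  continuous_one : Continuous one
  continuous_inv : Continuous inv
  continuous_mul : Continuous fun p : {p : Arr × Arr // src p.1 = tgt p.2} => mul p.1.1 p.1.2 p.2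

attribute [instance] TopGroupoid.topObj TopGroupoid.topArr

/-- An isomorphism of topological groupoids. -/
structure TopGroupoid.Iso (X Y : TopGroupoid) where
  obj : X.Obj ≃ₜ Y.Obj
  arr : X.Arr ≃ₜ Y.Arr
  map_src : ∀ a, Y.src (arr a) = obj (X.src a)
  map_tgt : ∀ a, Y.tgt (arr a) = obj (X.tgt a)
  map_mul : ∀ a b (h : X.src a = X.tgt b),
    arr (X.mul a b h) = Y.mul (arr a) (arr b) (by rw [map_src, map_tgt, h])

/-! ### Algebraic actions of Abelian monoids and their groupoids -/

/-- The action of an Abelian monoid `S` by injective endomorphisms on an Abelian group `A`, given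
inside a global action: `S` is a submonoid of a group `Γ`, `A` is an `S`-invariant subgroup of an
Abelian group `V` on which `Γ` acts by automorphisms. -/
structure AlgAct (Γ V : Type*) [Group Γ] [AddCommGroup V] [DistribMulAction Γ V] where
  S : Submonoid Γ
  A : AddSubgroup V
  comm : ∀ s ∈ S, ∀ t ∈ S, s * t = t * s
  smul_mem : ∀ s ∈ S, ∀ a ∈ A, s • a ∈ A

namespace AlgAct

variable {Γ V : Type*} [Group Γ] [AddCommGroup V] [DistribMulAction Γ V]

/-- The endomorphism `σ_s` of `A`. -/
def σ (α : AlgAct Γ V) (s : α.S) : α.A →+ α.A where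
  toFun a := ⟨(s : Γ) • (a : V), α.smul_mem s s.2 a a.2⟩
  map_zero' := by ext; simp
  map_add' a b := by ext; simp

/-- The smallest family of subgroups of `A` that contains `A` and is closed under `C ↦ σ_s C` and
`C ↦ σ_s⁻¹ C`. -/
inductive Constructible (α : AlgAct Γ V) : AddSubgroup α.A → Prop
  | top : Constructible α ⊤
  | map (s : α.S) (C : AddSubgroup α.A) : Constructible α C → Constructible α (C.map (α.σ s))
  | comap (s : α.S) (C : AddSubgroup α.A) : Constructible α C → Constructible α (C.comap (α.σ s))

/-- The completion `lim A ⧸ C` over the constructible subgroups `C`. -/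
def Completion (α : AlgAct Γ V) : Type _ :=
  {x : ∀ C : {C : AddSubgroup α.A // α.Constructible C}, α.A ⧸ C.1 //
    ∀ C D (h : C.1 ≤ D.1), QuotientAddGroup.map C.1 D.1 (AddMonoidHom.id α.A) h (x C) = x D}

/-- The inverse limit topology, every `A ⧸ C` being discrete. -/
instance (α : AlgAct Γ V) : TopologicalSpace α.Completion :=
  TopologicalSpace.induced Subtype.val (@Pi.topologicalSpace _ _ fun _ => ⊥)

/-- `a ∈ A` represents the component of `x` in `A ⧸ C`. -/
def Rep (α : AlgAct Γ V) (C : AddSubgroup α.A) (a : α.A) (x : α.Completion) : Prop :=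
  ∃ hC : α.Constructible C, x.1 ⟨C, hC⟩ = (a : α.A ⧸ C)

/-- The group `⟨S⟩` generated by `S`. -/
def grp (α : AlgAct Γ V) : Subgroup Γ := Subgroup.closure (α.S : Set Γ)

/-- The group `S⁻¹A = ⋃ₛ s⁻¹A`. -/
def frac (α : AlgAct Γ V) : AddSubgroup V where
  carrier := {x | ∃ s ∈ α.S, s • x ∈ α.A}
  zero_mem' := ⟨1, α.S.one_mem, by simp [α.A.zero_mem]⟩
  add_mem' := by
    rintro x y ⟨s, hs, hx⟩ ⟨t, ht, hy⟩
    refine ⟨s * t, α.S.mul_mem hs ht, ?_⟩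
    rw [smul_add]
    refine α.A.add_mem ?_ ?_
    · rw [α.comm s hs t ht, mul_smul]; exact α.smul_mem t ht _ hx
    · rw [mul_smul]; exact α.smul_mem s hs _ hy
  neg_mem' := by
    rintro x ⟨s, hs, hx⟩
    exact ⟨s, hs, by rw [smul_neg]; exact α.A.neg_mem hx⟩

theorem smul_mem_frac (α : AlgAct Γ V) {γ : Γ} (hγ : γ ∈ α.grp) {x : V} (hx : x ∈ α.frac) :
    γ • x ∈ α.frac := by
  suffices H : (∀ x ∈ α.frac, γ • x ∈ α.frac) ∧ (∀ x ∈ α.frac, γ⁻¹ • x ∈ α.frac) from H.1 x hx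
  clear hx x
  induction hγ using Subgroup.closure_induction with
  | mem t ht =>
    refine ⟨?_, ?_⟩
    · rintro x ⟨s, hs, hx⟩
      refine ⟨s, hs, ?_⟩
      rw [← mul_smul, α.comm s hs t ht, mul_smul]
      exact α.smul_mem t ht _ hx
    · rintro x ⟨s, hs, hx⟩
      exact ⟨s * t, α.S.mul_mem hs ht, by rw [mul_smul, smul_inv_smul]; exact hx⟩
  | one => simp
  | mul γ δ _ _ h h' =>
    refine ⟨fun x hx => ?_, fun x hx => ?_⟩
    · rw [mul_smul]; exact h.1 _ (h'.1 x hx)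
    · rw [mul_inv_rev, mul_smul]; exact h'.2 _ (h.2 x hx)
  | inv γ _ h => exact ⟨h.2, by simpa using h.1⟩

/-- The action of `Γ` on `V`, with `V` written multiplicatively. -/
def mulAct (Γ V : Type*) [Group Γ] [AddCommGroup V] [DistribMulAction Γ V] :
    Γ →* MulAut (Multiplicative V) :=
  (MulAutMultiplicative V).symm.toMonoidHom.comp (DistribMulAction.toAddAut Γ V)

/-- The affine action of `V ⋊ Γ` on `V`: `(z, γ).x = z + γ • x`. -/
def aff (g : Multiplicative V ⋊[mulAct Γ V] Γ) (x : V) : V := g.left.toAdd + g.right • x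

theorem aff_one (x : V) : aff (1 : Multiplicative V ⋊[mulAct Γ V] Γ) x = x := by
  simp [aff]

theorem aff_mul (g h : Multiplicative V ⋊[mulAct Γ V] Γ) (x : V) :
    aff (g * h) x = aff g (aff h x) := by
  simp only [aff, SemidirectProduct.mul_left, SemidirectProduct.mul_right, toAdd_mul, smul_add,
    mul_smul, add_assoc]
  rfl

/-- The group `S⁻¹A ⋊ ⟨S⟩`. -/
def affGrp (α : AlgAct Γ V) : Subgroup (Multiplicative V ⋊[mulAct Γ V] Γ) where
  carrier := {g | g.left.toAdd ∈ α.frac ∧ g.right ∈ α.grp}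
  one_mem' := ⟨α.frac.zero_mem, α.grp.one_mem⟩
  mul_mem' := by
    rintro g h ⟨h1, h2⟩ ⟨h3, h4⟩
    exact ⟨α.frac.add_mem h1 (α.smul_mem_frac h2 h3), α.grp.mul_mem h2 h4⟩
  inv_mem' := by
    rintro g ⟨h1, h2⟩
    exact ⟨α.smul_mem_frac (α.grp.inv_mem h2) (α.frac.neg_mem h1), α.grp.inv_mem h2⟩

/-- The extension to the completion of the partial action of `S⁻¹A ⋊ ⟨S⟩` on `A` by
`A ∩ g⁻¹.A → g.A ∩ A`, `a ↦ g.a`: the closure of its graph. Thus `α.Ext g x y` says that `x` lies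
in the domain of `g` and that `g.x = y`. -/
def Ext (α : AlgAct Γ V) (g : α.affGrp) (x y : α.Completion) : Prop :=
  ∀ C, α.Constructible C → ∃ a b : α.A, (b : V) = aff g.1 (a : V) ∧ α.Rep C a x ∧ α.Rep C b y

theorem σ_injective (α : AlgAct Γ V) (s : α.S) : Function.Injective (α.σ s) := by
  intro a b h
  have h' : (s : Γ) • (a : V) = (s : Γ) • (b : V) := congrArg Subtype.val h
  exact Subtype.ext (smul_left_cancel _ h')

theorem Constructible.inf {α : AlgAct Γ V} {C D : AddSubgroup α.A} (hC : α.Constructible C)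
    (hD : α.Constructible D) : α.Constructible (C ⊓ D) := by
  induction hD generalizing C with
  | top => simpa using hC
  | map s D _ ih =>
    have : C ⊓ D.map (α.σ s) = (C.comap (α.σ s) ⊓ D).map (α.σ s) := by
      ext x
      simp only [AddSubgroup.mem_inf, AddSubgroup.mem_map, AddSubgroup.mem_comap]
      constructor
      · rintro ⟨h, y, hy, rfl⟩; exact ⟨y, ⟨h, hy⟩, rfl⟩
      · rintro ⟨y, ⟨h, hy⟩, rfl⟩; exact ⟨h, y, hy, rfl⟩
    rw [this]
    exact .map _ _ (ih (.comap _ _ hC))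
  | comap s D _ ih =>
    have : C ⊓ D.comap (α.σ s) = (C.map (α.σ s) ⊓ D).comap (α.σ s) := by
      ext x
      simp only [AddSubgroup.mem_inf, AddSubgroup.mem_map, AddSubgroup.mem_comap]
      constructor
      · rintro ⟨h, hy⟩; exact ⟨⟨x, h, rfl⟩, hy⟩
      · rintro ⟨⟨y, h, e⟩, hy⟩; rw [α.σ_injective s e] at h; exact ⟨h, hy⟩
    rw [this]
    exact .comap _ _ (ih (.map _ _ hC))

theorem exists_constructible_smul (α : AlgAct Γ V) {γ : Γ} (hγ : γ ∈ α.grp)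
    {C : AddSubgroup α.A} (hC : α.Constructible C) :
    ∃ D, α.Constructible D ∧ ∀ d ∈ D, ∃ c ∈ C, (c : V) = γ • (d : V) := by
  suffices H : (∀ C, α.Constructible C →
      ∃ D, α.Constructible D ∧ ∀ d ∈ D, ∃ c ∈ C, (c : V) = γ • (d : V)) ∧
      (∀ C, α.Constructible C →
      ∃ D, α.Constructible D ∧ ∀ d ∈ D, ∃ c ∈ C, (c : V) = γ⁻¹ • (d : V)) from H.1 C hC
  clear hC C
  induction hγ using Subgroup.closure_induction with
  | mem t ht =>
    refine ⟨fun C hC => ⟨C.comap (α.σ ⟨t, ht⟩), .comap _ _ hC, fun d hd => ⟨_, hd, rfl⟩⟩,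
      fun C hC => ⟨C.map (α.σ ⟨t, ht⟩), .map _ _ hC, ?_⟩⟩
    rintro _ ⟨c, hc, rfl⟩
    exact ⟨c, hc, (inv_smul_smul t (c : V)).symm⟩
  | one => exact ⟨fun C hC => ⟨C, hC, fun d hd => ⟨d, hd, by simp⟩⟩,
      fun C hC => ⟨C, hC, fun d hd => ⟨d, hd, by simp⟩⟩⟩
  | mul γ δ _ _ h h' =>
    refine ⟨fun C hC => ?_, fun C hC => ?_⟩
    · obtain ⟨D, hD, hD'⟩ := h.1 C hC
      obtain ⟨E, hE, hE'⟩ := h'.1 D hD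
      refine ⟨E, hE, fun e he => ?_⟩
      obtain ⟨d, hd, h1⟩ := hE' e he
      obtain ⟨c, hc, h2⟩ := hD' d hd
      exact ⟨c, hc, by rw [h2, h1, mul_smul]⟩
    · obtain ⟨D, hD, hD'⟩ := h'.2 C hC
      obtain ⟨E, hE, hE'⟩ := h.2 D hD
      refine ⟨E, hE, fun e he => ?_⟩
      obtain ⟨d, hd, h1⟩ := hE' e he
      obtain ⟨c, hc, h2⟩ := hD' d hd
      exact ⟨c, hc, by rw [h2, h1, mul_inv_rev, mul_smul]⟩
  | inv γ _ h => exact ⟨h.2, by simpa using h.1⟩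

theorem Rep.mono {α : AlgAct Γ V} {C D : AddSubgroup α.A} {a : α.A} {x : α.Completion}
    (h : α.Rep C a x) (hD : α.Constructible D) (hCD : C ≤ D) : α.Rep D a x := by
  obtain ⟨hC, h⟩ := h
  refine ⟨hD, ?_⟩
  rw [← x.2 ⟨C, hC⟩ ⟨D, hD⟩ hCD, h]
  rfl

theorem Rep.sub_mem {α : AlgAct Γ V} {C : AddSubgroup α.A} {a b : α.A} {x : α.Completion}
    (h : α.Rep C a x) (h' : α.Rep C b x) : b - a ∈ C := by
  obtain ⟨hC, h⟩ := h
  obtain ⟨_, h'⟩ := h'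
  have := h.symm.trans h'
  rw [QuotientAddGroup.eq] at this
  rwa [sub_eq_add_neg, add_comm]

theorem Rep.congr {α : AlgAct Γ V} {C : AddSubgroup α.A} {a b : α.A} {x : α.Completion}
    (h : α.Rep C a x) (hab : b - a ∈ C) : α.Rep C b x := by
  obtain ⟨hC, h⟩ := h
  refine ⟨hC, h.trans ?_⟩
  rw [QuotientAddGroup.eq]
  rwa [sub_eq_add_neg, add_comm] at hab

theorem exists_rep {α : AlgAct Γ V} {C : AddSubgroup α.A} (hC : α.Constructible C)
    (x : α.Completion) : ∃ a, α.Rep C a x := by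
  obtain ⟨a, ha⟩ := QuotientAddGroup.mk_surjective (x.1 ⟨C, hC⟩)
  exact ⟨a, hC, ha.symm⟩

theorem completion_ext {α : AlgAct Γ V} {x y : α.Completion}
    (h : ∀ C, α.Constructible C → ∃ a, α.Rep C a x ∧ α.Rep C a y) : x = y := by
  apply Subtype.ext
  funext C
  obtain ⟨a, ⟨_, h1⟩, ⟨_, h2⟩⟩ := h C.1 C.2
  exact h1.trans h2.symm

/-- If `a` approximates `x` well enough and `x` is in the domain of `g`, then so is `a`, and `g.a`
approximates `g.x`. -/
theorem Ext.approx {α : AlgAct Γ V} (g : α.affGrp) {C : AddSubgroup α.A}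
    (hC : α.Constructible C) : ∃ D, α.Constructible D ∧ ∀ x y a, α.Ext g x y → α.Rep D a x →
      ∃ b : α.A, (b : V) = aff g.1 (a : V) ∧ α.Rep C b y := by
  obtain ⟨D, hD, hD'⟩ := α.exists_constructible_smul g.2.2 hC
  refine ⟨D, hD, fun x y a h ha => ?_⟩
  obtain ⟨a', b', e, h1, h2⟩ := h _ (hC.inf hD)
  obtain ⟨c, hc, ec⟩ := hD' _ ((h1.mono hD inf_le_right).sub_mem ha)
  refine ⟨b' + c, ?_, (h2.mono hC inf_le_left).congr (by simpa using hc)⟩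
  rw [AddSubgroup.coe_add, e, ec]
  simp only [aff, AddSubgroup.coe_sub, smul_sub]
  abel

theorem Ext.unique {α : AlgAct Γ V} {g : α.affGrp} {x y z : α.Completion} (h : α.Ext g x y)
    (h' : α.Ext g x z) : y = z := by
  refine completion_ext fun C hC => ?_
  obtain ⟨D, hD, H⟩ := Ext.approx g hC
  obtain ⟨a, ha⟩ := exists_rep hD x
  obtain ⟨b, hb, h1⟩ := H x y a h ha
  obtain ⟨b', hb', h2⟩ := H x z a h' ha
  have : b = b' := Subtype.ext (hb.trans hb'.symm)
  exact ⟨b, h1, this ▸ h2⟩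

theorem Ext.one {α : AlgAct Γ V} (x : α.Completion) : α.Ext 1 x x := by
  intro C hC
  obtain ⟨a, ha⟩ := exists_rep hC x
  exact ⟨a, a, (aff_one _).symm, ha, ha⟩

theorem Ext.inv {α : AlgAct Γ V} {g : α.affGrp} {x y : α.Completion} (h : α.Ext g x y) :
    α.Ext g⁻¹ y x := by
  intro C hC
  obtain ⟨a, b, e, h1, h2⟩ := h C hC
  refine ⟨b, a, ?_, h2, h1⟩
  rw [e, ← aff_mul, Subgroup.coe_inv, inv_mul_cancel, aff_one]

theorem Ext.mul {α : AlgAct Γ V} {g h : α.affGrp} {x y z : α.Completion} (hh : α.Ext h x y)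
    (hg : α.Ext g y z) : α.Ext (g * h) x z := by
  intro C hC
  obtain ⟨D, hD, H⟩ := Ext.approx g hC
  obtain ⟨a, b, e, h1, h2⟩ := hh _ (hC.inf hD)
  obtain ⟨c, hc, h3⟩ := H y z b hg (h2.mono hD inf_le_right)
  exact ⟨a, c, by rw [hc, e, Subgroup.coe_mul, aff_mul], h1.mono hC inf_le_left, h3⟩

/-- The set `{(g, x) : x in the domain of g}`. -/
def Arrow (α : AlgAct Γ V) : Type _ :=
  {p : α.affGrp × α.Completion // ∃ y, α.Ext p.1 p.2 y}

/-- The subspace topology of `(S⁻¹A ⋊ ⟨S⟩) × Ā`, the group being discrete. -/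
instance (α : AlgAct Γ V) : TopologicalSpace α.Arrow :=
  TopologicalSpace.induced Subtype.val (@instTopologicalSpaceProd _ _ ⊥ _)

namespace Arrow

variable {α : AlgAct Γ V}

/-- The point `g.x`. -/
noncomputable def tgt (p : α.Arrow) : α.Completion := p.2.choose

theorem tgt_spec (p : α.Arrow) : α.Ext p.1.1 p.1.2 p.tgt := p.2.choose_spec

theorem tgt_eq (p : α.Arrow) {y : α.Completion} (h : α.Ext p.1.1 p.1.2 y) : p.tgt = y :=
  p.tgt_spec.unique h

theorem continuous_src : Continuous fun p : α.Arrow => p.1.2 := by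
  let : TopologicalSpace α.affGrp := ⊥
  exact continuous_snd.comp continuous_induced_dom

theorem continuous_grp : @Continuous _ _ _ ⊥ fun p : α.Arrow => p.1.1 := by
  let : TopologicalSpace α.affGrp := ⊥
  exact continuous_fst.comp continuous_induced_dom

theorem continuous_iff {X : Type*} [TopologicalSpace X] {f : X → α.Arrow} :
    Continuous f ↔ (@Continuous _ _ _ ⊥ fun x => (f x).1.1) ∧ Continuous fun x => (f x).1.2 := by
  let : TopologicalSpace α.affGrp := ⊥
  rw [continuous_induced_rng]
  exact continuous_prodMk (f := fun x => (f x).1.1) (g := fun x => (f x).1.2)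

theorem isOpen_rep (C : AddSubgroup α.A) (a : α.A) : IsOpen {x : α.Completion | α.Rep C a x} := by
  by_cases hC : α.Constructible C
  · let : ∀ C : {C : AddSubgroup α.A // α.Constructible C}, TopologicalSpace (α.A ⧸ C.1) :=
      fun _ => ⊥
    have : ∀ C : {C : AddSubgroup α.A // α.Constructible C}, DiscreteTopology (α.A ⧸ C.1) :=
      fun _ => ⟨rfl⟩
    have h : Continuous fun x : α.Completion => x.1 ⟨C, hC⟩ :=
      (continuous_apply _).comp continuous_induced_dom
    have ho := (isOpen_discrete (α := α.A ⧸ (⟨C, hC⟩ : {C // α.Constructible C}).1)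
      {(a : α.A ⧸ C)}).preimage h
    convert ho using 1
    ext x
    exact ⟨fun ⟨_, h⟩ => h, fun h => ⟨hC, h⟩⟩
  · convert isOpen_empty
    ext x
    exact ⟨fun ⟨h, _⟩ => hC h, fun h => h.elim⟩

theorem continuous_completion {X : Type*} [TopologicalSpace X] {f : X → α.Completion}
    (h : ∀ C a, IsOpen {x | α.Rep C a (f x)}) : Continuous f := by
  let : ∀ C : {C : AddSubgroup α.A // α.Constructible C}, TopologicalSpace (α.A ⧸ C.1) :=
    fun _ => ⊥
  have : ∀ C : {C : AddSubgroup α.A // α.Constructible C}, DiscreteTopology (α.A ⧸ C.1) :=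
    fun _ => ⟨rfl⟩
  refine continuous_induced_rng.2 (continuous_pi fun C => ?_)
  rw [continuous_discrete_rng]
  intro q
  obtain ⟨a, rfl⟩ := QuotientAddGroup.mk_surjective q
  convert h C.1 a using 1
  ext x
  exact ⟨fun h => ⟨C.2, h⟩, fun ⟨_, h⟩ => h⟩

theorem continuous_tgt : Continuous (tgt : α.Arrow → α.Completion) := by
  refine continuous_completion fun C a => ?_
  rw [isOpen_iff_mem_nhds]
  intro p hp
  obtain ⟨hC, -⟩ := id hp
  obtain ⟨D, hD, H⟩ := Ext.approx p.1.1 hC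
  obtain ⟨d, hd⟩ := exists_rep hD p.1.2
  obtain ⟨b, hb, h1⟩ := H _ _ d p.tgt_spec hd
  have ho : IsOpen {q : α.Arrow | q.1.1 = p.1.1 ∧ α.Rep D d q.1.2} := by
    let : TopologicalSpace α.affGrp := ⊥
    have : DiscreteTopology α.affGrp := ⟨rfl⟩
    exact ((isOpen_discrete {p.1.1}).preimage continuous_grp).inter
      ((isOpen_rep D d).preimage continuous_src)
  refine Filter.mem_of_superset (ho.mem_nhds ⟨rfl, hd⟩) ?_
  rintro q ⟨hq, hq'⟩
  obtain ⟨b', hb', h2⟩ := H _ _ d (hq ▸ q.tgt_spec) hq'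
  have : b' = b := Subtype.ext (hb'.trans hb.symm)
  subst this
  exact h2.congr (h1.sub_mem hp)

end Arrow

/-- The partial transformation groupoid `(S⁻¹A ⋊ ⟨S⟩) ⋉ Ā`. -/
noncomputable def groupoid (α : AlgAct Γ V) : TopGroupoid where
  Obj := α.Completion
  Arr := α.Arrow
  src p := p.1.2
  tgt p := p.tgt
  one x := ⟨(1, x), x, .one x⟩
  inv p := ⟨(p.1.1⁻¹, p.tgt), p.1.2, p.tgt_spec.inv⟩
  mul p q h := ⟨(p.1.1 * q.1.1, q.1.2), p.tgt, q.tgt_spec.mul (h ▸ p.tgt_spec)⟩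
  src_one _ := rfl
  tgt_one x := Arrow.tgt_eq _ (.one x)
  src_inv _ := rfl
  tgt_inv p := Arrow.tgt_eq _ p.tgt_spec.inv
  src_mul _ _ _ := rfl
  tgt_mul p q h := Arrow.tgt_eq _ (q.tgt_spec.mul (h ▸ p.tgt_spec))
  mul_one p := Subtype.ext (Prod.ext (_root_.mul_one _) rfl)
  one_mul p := Subtype.ext (Prod.ext (_root_.one_mul _) rfl)
  mul_assoc _ _ _ _ _ := Subtype.ext (Prod.ext (_root_.mul_assoc _ _ _) rfl)
  inv_mul p := Subtype.ext (Prod.ext (inv_mul_cancel _) rfl)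
  mul_inv p := Subtype.ext (Prod.ext (mul_inv_cancel _) rfl)
  continuous_src := Arrow.continuous_src
  continuous_tgt := Arrow.continuous_tgt
  continuous_one := by
    let : TopologicalSpace α.affGrp := ⊥
    exact Arrow.continuous_iff.2 ⟨continuous_const, continuous_id⟩
  continuous_inv := by
    let : TopologicalSpace α.affGrp := ⊥
    have : DiscreteTopology α.affGrp := ⟨rfl⟩
    refine Arrow.continuous_iff.2 ⟨?_, Arrow.continuous_tgt⟩
    exact (continuous_of_discreteTopology (f := fun g : α.affGrp => g⁻¹)).comp Arrow.continuous_grp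
  continuous_mul := by
    let : TopologicalSpace α.affGrp := ⊥
    have : DiscreteTopology α.affGrp := ⟨rfl⟩
    refine Arrow.continuous_iff.2 ⟨?_, ?_⟩
    · exact (continuous_of_discreteTopology (f := fun p : α.affGrp × α.affGrp => p.1 * p.2)).comp
        ((Arrow.continuous_grp.comp (continuous_fst.comp continuous_subtype_val)).prodMk
          (Arrow.continuous_grp.comp (continuous_snd.comp continuous_subtype_val)))
    · exact Arrow.continuous_src.comp (f := fun p :
        {p : α.Arrow × α.Arrow // p.1.1.2 = p.2.tgt} => p.1.2)
        (continuous_snd.comp continuous_subtype_val)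

end AlgAct

/-! ### Algebraic actions from rings -/

/-- The `ℚ`-algebra `ℚR = ℚ ⊗ R`. -/
abbrev QR (R : Type*) [Ring R] : Type _ := ℚ ⊗[ℤ] R

namespace QR

variable {R : Type*} [Ring R]

/-- The canonical map `R → ℚR`. -/
def ι : R →+* QR R := (Algebra.TensorProduct.includeRight : R →ₐ[ℤ] QR R).toRingHom

/-- Left regular elements of `R` are invertible in `ℚR`. -/
theorem isUnit_ι [Module.Finite ℤ R] {a : R} (ha : IsLeftRegular a) : IsUnit (ι a) := by
  have h1 : Function.Injective (LinearMap.mulLeft ℤ a : R →ₗ[ℤ] R) := ha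
  have h2 : Function.Injective ((LinearMap.mulLeft ℤ a).baseChange ℚ : QR R →ₗ[ℚ] QR R) :=
    Module.Flat.lTensor_preserves_injective_linearMap (M := ℚ) _ h1
  have h3 : ∀ x : QR R, (LinearMap.mulLeft ℤ a).baseChange ℚ x = ι a * x := by
    intro x
    induction x using TensorProduct.induction_on with
    | zero => simp
    | add x y hx hy => rw [map_add, hx, hy, mul_add]
    | tmul q r => simp [ι]
  obtain ⟨b, hb⟩ := LinearMap.injective_iff_surjective.1 h2 1
  rw [h3] at hb
  have : IsArtinianRing (QR R) := IsArtinianRing.of_finite ℚ (QR R)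
  exact IsUnit.of_mul_eq_one b hb

/-- A submonoid `M` of `R`, consisting of left regular elements, as a submonoid of `(ℚR)ˣ`. -/
def units (M : Submonoid R) : Submonoid (QR R)ˣ :=
  (M.map (ι (R := R))).comap (Units.coeHom (QR R))

/-- The set of elements of `ℚR` that are integral over `ℤ`. -/
def integers (R : Type*) [Ring R] : Set (QR R) := {x | IsIntegral ℤ x}

/-- `M̃ = ⟨M⟩ ∩ 𝒪`, with `⟨M⟩` the subgroup of `(ℚR)ˣ` generated by `M`. -/
def tilde (M : Submonoid R) : Set (QR R) :=
  {x | ∃ u ∈ Subgroup.closure (units M : Set (QR R)ˣ), (u : QR R) = x} ∩ integers R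

/-- `L` is a full rank subgroup of `ℚR`, i.e. `ℚL = ℚR`. -/
def IsFullRank (L : AddSubgroup (QR R)) : Prop := Submodule.span ℚ (L : Set (QR R)) = ⊤

/-- The action of the Abelian monoid `M` on `L` by left multiplication, inside the action of `(ℚR)ˣ`
on `ℚR`. -/
def action (M : Submonoid R) (L : AddSubgroup (QR R)) (hM : ∀ a ∈ M, ∀ b ∈ M, a * b = b * a)
    (hL : ∀ a ∈ M, ∀ x ∈ L, ι a * x ∈ L) : AlgAct (QR R)ˣ (QR R) where
  S := units M
  A := L
  comm := by
    rintro s ⟨a, ha, hs⟩ t ⟨b, hb, ht⟩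
    apply Units.ext
    change ι a = (s : QR R) at hs
    change ι b = (t : QR R) at ht
    rw [Units.val_mul, Units.val_mul, ← hs, ← ht, ← map_mul, ← map_mul, hM a ha b hb]
  smul_mem := by
    rintro s ⟨a, ha, hs⟩ x hx
    change ι a = (s : QR R) at hs
    rw [Units.smul_def, smul_eq_mul, ← hs]
    exact hL a ha x hx

/-- The algebraic actions of `M₁` on `L₁` and of `M₂` on `L₂` by left multiplication are
isomorphic. -/
def ActionsIsomorphic {R₁ R₂ : Type*} [Ring R₁] [Ring R₂] (M₁ : Submonoid R₁) (M₂ : Submonoid R₂)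
    (L₁ : AddSubgroup (QR R₁)) (L₂ : AddSubgroup (QR R₂)) : Prop :=
  ∃ (t : M₁ ≃* M₂) (b : L₁ ≃+ L₂), ∀ (a : M₁) (x y : L₁),
    (y : QR R₁) = ι (a : R₁) * (x : QR R₁) → (b y : QR R₂) = ι (t a : R₂) * (b x : QR R₂)

end QR

/-! The group component of the image arrow under a groupoid isomorphism is a continuous cocycle `c`
on the first groupoid, with values in the discrete affine group of the second. The aim is to read
off from `c` a linear map between the rational vector spaces.

Restrict `c` to translations. A finitely generated full rank subgroup `A₀` of `A` has compact
closure in the completion: each quotient `A ⧸ C` has bounded exponent, so the image of `A₀` in it is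
finite. Compactness and the cocycle identity give one constructible `C` such that `c(a, x)`, for `a
∈ A₀` and `x` in the closure of `A₀`, depends only on `x` modulo `C` (`exists_atShift_eq`). Hence
`h(a) = c(a, 0)` is a homomorphism on `A₀ ∩ C`. It is injective, because an arrow is determined by
its source and its cocycle value.

The values of `h` are affine maps and may have a linear part. Let `d = c(s, 0)` be the value at the
dilation by `s`. Then `d h(a) = h(sa) d` for `a` close to `0`. The linear parts lie in an Abelian
group, so `h(a)` and `h(sa)` have the same one, and `h(a - sa)` is a translation. When `1 - s` is
invertible on `V`, such elements fill a subgroup of full rank. There `h` is an injective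
homomorphism to translations, so it extends to an injective `ℚ`-linear `F`. The same relation, now
for every `s`, says that `F` intertwines `s` with the linear part of its `d`
(`exists_linearMap_of_iso`).

For rings, the inverse isomorphism gives an injection the other way, so dimensions agree and `F` is
bijective. As `M₁` spans `ℚR₁`, `F` is semilinear along an algebra isomorphism
(`LinearEquiv.exists_algEquiv`), which sends `M₁` into `⟨M₂⟩` and preserves integrality. This is
(1). In (2), conditions (N) and (S) turn these inclusions into equalities, and an algebra
isomorphism matching the monoids also matches the `L_i`. Conversely, an isomorphism of actions
extends to the ambient algebras and can be transported to the groupoids. -/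

/-! ### Subgroups of full rank in rational vector spaces -/

/-- Every element of `V` has a positive multiple in `B`. -/
def AddSubgroup.IsLarge {V : Type*} [AddCommGroup V] (B : AddSubgroup V) : Prop :=
  ∀ v : V, ∃ n : ℕ, 0 < n ∧ n • v ∈ B

namespace AddSubgroup.IsLarge

variable {V W : Type*} [AddCommGroup V] [AddCommGroup W]

theorem inf {B C : AddSubgroup V} (hB : B.IsLarge) (hC : C.IsLarge) : (B ⊓ C).IsLarge := by
  intro v
  obtain ⟨m, hm, h1⟩ := hB v
  obtain ⟨n, hn, h2⟩ := hC v
  refine ⟨m * n, mul_pos hm hn, ?_, ?_⟩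
  · rw [mul_comm, mul_smul]; exact B.nsmul_mem h1 n
  · rw [mul_smul]; exact C.nsmul_mem h2 m

theorem comap {B : AddSubgroup W} (hB : B.IsLarge) (f : V →+ W) : (B.comap f).IsLarge := by
  intro v
  obtain ⟨n, hn, h⟩ := hB (f v)
  exact ⟨n, hn, by rwa [AddSubgroup.mem_comap, map_nsmul]⟩

theorem of_span_eq_top [Module ℚ V] {B : AddSubgroup V}
    (h : Submodule.span ℚ (B : Set V) = ⊤) : B.IsLarge := by
  intro v
  have hv : v ∈ Submodule.span ℚ (B : Set V) := h ▸ Submodule.mem_top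
  induction hv using Submodule.span_induction with
  | mem x hx => exact ⟨1, one_pos, by simpa using hx⟩
  | zero => exact ⟨1, one_pos, by simp⟩
  | add x y _ _ hx hy =>
    obtain ⟨m, hm, h1⟩ := hx
    obtain ⟨n, hn, h2⟩ := hy
    refine ⟨m * n, mul_pos hm hn, ?_⟩
    rw [smul_add]
    refine B.add_mem ?_ ?_
    · rw [mul_comm, mul_smul]; exact B.nsmul_mem h1 n
    · rw [mul_smul]; exact B.nsmul_mem h2 m
  | smul q x _ hx =>
    obtain ⟨m, hm, h1⟩ := hx
    refine ⟨q.den * m, mul_pos q.den_pos hm, ?_⟩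
    have : (q.den * m) • q • x = q.num • (m • x) := by
      rw [← Nat.cast_smul_eq_nsmul ℚ, ← Nat.cast_smul_eq_nsmul ℚ, ← Int.cast_smul_eq_zsmul ℚ,
        smul_smul, smul_smul]
      congr 1
      rw [Nat.cast_mul, mul_right_comm, mul_comm (q.den : ℚ), Rat.mul_den_eq_num]
    rw [this]
    exact B.zsmul_mem h1 _

theorem span_eq_top [Module ℚ V] {B : AddSubgroup V} (h : B.IsLarge) :
    Submodule.span ℚ (B : Set V) = ⊤ := by
  rw [eq_top_iff]
  intro v _
  obtain ⟨n, hn, hv⟩ := h v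
  have : v = (n : ℚ)⁻¹ • (n • v) := by
    rw [← Nat.cast_smul_eq_nsmul ℚ, inv_smul_smul₀ (by positivity)]
  rw [this]
  exact Submodule.smul_mem _ _ (Submodule.subset_span hv)

theorem eq_of_eqOn [IsAddTorsionFree W] {B : AddSubgroup V} (h : B.IsLarge) {f g : V →+ W}
    (hfg : ∀ b ∈ B, f b = g b) : f = g := by
  ext v
  obtain ⟨n, hn, hv⟩ := h v
  have := hfg _ hv
  rw [map_nsmul, map_nsmul] at this
  exact nsmul_right_injective hn.ne' this

/-- A homomorphism from a subgroup of a rational vector space to another one extends to a linear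
map. -/
theorem exists_linearMap_extension [Module ℚ V] [Module ℚ W] {B : Type*}
    [AddCommGroup B] {i : B →+ V} (hi : Function.Injective i) (f : B →+ W) :
    ∃ F : V →ₗ[ℚ] W, ∀ b : B, F (i b) = f b := by
  -- A rational vector space is divisible, hence injective as an Abelian group, and additive maps
  -- between rational vector spaces are linear.
  let : DivisibleBy W ℤ :=
    { div := fun x n => (n : ℚ)⁻¹ • x
      div_zero := fun x => by simp
      div_cancel := fun x hn => by
        rw [← Int.cast_smul_eq_zsmul ℚ, smul_inv_smul₀ (by exact_mod_cast hn)] }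
  obtain ⟨h, hh⟩ := (Module.Baer.of_divisible W).extension_property_addMonoidHom
    i hi f
  exact ⟨h.toRatLinearMap, fun b => DFunLike.congr_fun hh b⟩

/-- A subgroup of full rank contains a finitely generated one. -/
theorem exists_fg [Module ℚ V] [Module.Finite ℚ V] {B : AddSubgroup V} (h : B.IsLarge) :
    ∃ B₀ : AddSubgroup V, B₀.FG ∧ B₀ ≤ B ∧ B₀.IsLarge := by
  classical
  obtain ⟨s, hs⟩ := Module.Finite.fg_top (R := ℚ) (M := V)
  choose n hn hB using h
  refine ⟨AddSubgroup.closure (s.image fun v => n v • v : Finset V), ⟨_, rfl⟩, ?_, ?_⟩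
  · rw [AddSubgroup.closure_le]
    intro x hx
    obtain ⟨v, -, rfl⟩ := Finset.mem_image.1 hx
    exact hB v
  · apply of_span_eq_top
    rw [eq_top_iff, ← hs, Submodule.span_le]
    intro v hv
    have : v = (n v : ℚ)⁻¹ • (n v • v) := by
      rw [← Nat.cast_smul_eq_nsmul ℚ, inv_smul_smul₀ (by exact_mod_cast (hn v).ne')]
    rw [this]
    exact Submodule.smul_mem _ _ (Submodule.subset_span (AddSubgroup.subset_closure
      (Finset.mem_image_of_mem (fun v => n v • v) hv)))

end AddSubgroup.IsLarge

namespace AlgAct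

variable {Γ V : Type*} [Group Γ] [AddCommGroup V] [DistribMulAction Γ V]

/-! ### The completion -/

/-- The canonical map `A → Ā`. -/
def embed (α : AlgAct Γ V) (a : α.A) : α.Completion :=
  ⟨fun C => (a : α.A ⧸ C.1), fun _ _ _ => rfl⟩

/-- `x` and `y` have the same component in `A ⧸ C`. -/
def Agree (α : AlgAct Γ V) (C : AddSubgroup α.A) (x y : α.Completion) : Prop :=
  ∃ a, α.Rep C a x ∧ α.Rep C a y

section

variable {α : AlgAct Γ V}

theorem rep_embed {C : AddSubgroup α.A} (hC : α.Constructible C) (a : α.A) :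
    α.Rep C a (α.embed a) := ⟨hC, rfl⟩

theorem ext_embed {g : α.affGrp} {a b : α.A} (h : (b : V) = aff g.1 (a : V)) :
    α.Ext g (α.embed a) (α.embed b) :=
  fun _ hC => ⟨a, b, h, rep_embed hC a, rep_embed hC b⟩

theorem Agree.symm {C : AddSubgroup α.A} {x y : α.Completion} (h : α.Agree C x y) :
    α.Agree C y x :=
  let ⟨a, h1, h2⟩ := h
  ⟨a, h2, h1⟩

theorem Agree.trans {C : AddSubgroup α.A} {x y z : α.Completion} (h : α.Agree C x y)
    (h' : α.Agree C y z) : α.Agree C x z := by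
  obtain ⟨a, h1, h2⟩ := h
  obtain ⟨b, h3, h4⟩ := h'
  exact ⟨a, h1, h4.congr (h3.sub_mem h2)⟩

theorem Agree.mono {C D : AddSubgroup α.A} {x y : α.Completion} (h : α.Agree C x y)
    (hD : α.Constructible D) (hCD : C ≤ D) : α.Agree D x y :=
  let ⟨a, h1, h2⟩ := h
  ⟨a, h1.mono hD hCD, h2.mono hD hCD⟩

theorem agree_refl {C : AddSubgroup α.A} (hC : α.Constructible C) (x : α.Completion) :
    α.Agree C x x :=
  let ⟨a, h⟩ := exists_rep hC x
  ⟨a, h, h⟩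

theorem agree_embed {C : AddSubgroup α.A} (hC : α.Constructible C) {a b : α.A}
    (h : b - a ∈ C) : α.Agree C (α.embed a) (α.embed b) :=
  ⟨b, (rep_embed hC a).congr h, rep_embed hC b⟩

theorem isOpen_agree {C : AddSubgroup α.A} (x : α.Completion) :
    IsOpen {y | α.Agree C x y} := by
  by_cases hC : α.Constructible C
  · obtain ⟨a, ha⟩ := exists_rep hC x
    convert Arrow.isOpen_rep C a using 1
    ext y
    exact ⟨fun ⟨b, h1, h2⟩ => h2.congr (h1.sub_mem ha), fun h => ⟨a, ha, h⟩⟩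
  · convert isOpen_empty
    ext y
    exact ⟨fun ⟨_, ⟨h, _⟩, _⟩ => hC h, fun h => h.elim⟩

theorem Constructible.finset_inf {ι : Type*} (s : Finset ι) (C : ι → AddSubgroup α.A)
    (h : ∀ i ∈ s, α.Constructible (C i)) : α.Constructible (s.inf C) :=
  Finset.inf_induction .top (fun _ hC _ hD => hC.inf hD) h

/-- A basic neighbourhood restricts finitely many components, and these are all controlled by the
intersection of the corresponding subgroups, which is constructible. -/
theorem exists_agree_subset {U : Set α.Completion} (hU : IsOpen U) {x : α.Completion}
    (hx : x ∈ U) : ∃ C, α.Constructible C ∧ ∀ y, α.Agree C x y → y ∈ U := by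
  let : ∀ C : {C : AddSubgroup α.A // α.Constructible C}, TopologicalSpace (α.A ⧸ C.1) :=
    fun _ => ⊥
  obtain ⟨W, hW, rfl⟩ := isOpen_induced_iff.1 hU
  obtain ⟨I, u, hu, hI⟩ := isOpen_pi_iff.1 hW _ hx
  refine ⟨I.inf Subtype.val, .finset_inf _ _ fun C _ => C.2, fun y hy => hI ?_⟩
  intro C hC
  obtain ⟨a, ⟨_, h1⟩, ⟨_, h2⟩⟩ := hy.mono C.2 (Finset.inf_le (f := Subtype.val) hC)
  have : y.1 C = x.1 C := h2.trans h1.symm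
  rw [this]
  exact (hu C hC).2

/-- Exponents multiply along images and do not change along preimages. The quotient `A ⧸ C` itself
may be infinite; its bounded exponent is what compactness needs. -/
theorem exists_nsmul_mem_of_constructible
    (hα : ∀ s : α.S, ∃ n : ℕ, 0 < n ∧ ∀ a, n • a ∈ (α.σ s).range) {C : AddSubgroup α.A}
    (hC : α.Constructible C) : ∃ n : ℕ, 0 < n ∧ ∀ a, n • a ∈ C := by
  induction hC with
  | top => exact ⟨1, one_pos, fun _ => trivial⟩
  | map s C _ ih =>
    obtain ⟨m, hm, h⟩ := ih
    obtain ⟨n, hn, h'⟩ := hα s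
    refine ⟨m * n, mul_pos hm hn, fun a => ?_⟩
    obtain ⟨b, hb⟩ := h' a
    rw [mul_smul, ← hb, ← map_nsmul]
    exact ⟨_, h b, rfl⟩
  | comap s C _ ih =>
    obtain ⟨m, hm, h⟩ := ih
    exact ⟨m, hm, fun a => by rw [AddSubgroup.mem_comap, map_nsmul]; exact h _⟩

end

/-- The closure in `Ā` of a subgroup of `A`. -/
def closureSet (α : AlgAct Γ V) (A₀ : AddSubgroup α.A) : Set α.Completion :=
  {x | ∀ C, α.Constructible C → ∃ a ∈ A₀, α.Rep C a x}

section

variable {α : AlgAct Γ V}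

theorem embed_mem_closureSet {A₀ : AddSubgroup α.A} {a : α.A} (ha : a ∈ A₀) :
    α.embed a ∈ α.closureSet A₀ := fun _ hC => ⟨a, ha, rep_embed hC a⟩

/-- The image is a finitely generated Abelian group killed by `n`. -/
theorem finite_image_mk {A : Type*} [AddCommGroup A] {A₀ C : AddSubgroup A} (hA₀ : A₀.FG)
    {n : ℕ} (hn : 0 < n) (h : ∀ a, n • a ∈ C) :
    ((QuotientAddGroup.mk : A → A ⧸ C) '' A₀).Finite := by
  have : AddGroup.FG A₀ := (AddGroup.fg_iff_addSubgroup_fg _).2 hA₀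
  have : AddGroup.FG (A₀.map (QuotientAddGroup.mk' C)) :=
    AddGroup.fg_of_surjective ((QuotientAddGroup.mk' C).addSubgroupMap_surjective A₀)
  have hf : Finite (A₀.map (QuotientAddGroup.mk' C)) := by
    refine AddCommGroup.finite_of_fg_isAddTorsion _ ?_
    rintro ⟨_, a, ha, rfl⟩
    refine isOfFinAddOrder_iff_nsmul_eq_zero.2 ⟨n, hn, Subtype.ext ?_⟩
    change n • (QuotientAddGroup.mk' C a) = 0
    rw [← map_nsmul]
    exact (QuotientAddGroup.eq_zero_iff _).2 (h a)
  exact Set.toFinite (A₀.map (QuotientAddGroup.mk' C) : Set (A ⧸ C))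

/-- Tychonoff: inside the product of the `A ⧸ C` the set is the intersection of a product of finite
sets with the closed set of compatible families. -/
theorem isCompact_closureSet
    (hα : ∀ s : α.S, ∃ n : ℕ, 0 < n ∧ ∀ a, n • a ∈ (α.σ s).range) {A₀ : AddSubgroup α.A}
    (hA₀ : A₀.FG) : IsCompact (α.closureSet A₀) := by
  let : ∀ C : {C : AddSubgroup α.A // α.Constructible C}, TopologicalSpace (α.A ⧸ C.1) :=
    fun _ => ⊥
  have : ∀ C : {C : AddSubgroup α.A // α.Constructible C}, DiscreteTopology (α.A ⧸ C.1) :=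
    fun _ => ⟨rfl⟩
  have hind : Topology.IsInducing (fun x : α.Completion => x.1) := ⟨rfl⟩
  rw [hind.isCompact_iff]
  let T : ∀ C : {C : AddSubgroup α.A // α.Constructible C}, Set (α.A ⧸ C.1) :=
    fun C => (QuotientAddGroup.mk : α.A → α.A ⧸ C.1) '' A₀
  have hT : IsCompact (Set.univ.pi T) := by
    refine isCompact_univ_pi fun C => ?_
    obtain ⟨n, hn, h⟩ := exists_nsmul_mem_of_constructible hα C.2
    exact (finite_image_mk (C := C.1) hA₀ hn h).isCompact
  have hZ : IsClosed {x : ∀ C : {C : AddSubgroup α.A // α.Constructible C}, α.A ⧸ C.1 |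
      ∀ C D (h : C.1 ≤ D.1),
        QuotientAddGroup.map C.1 D.1 (AddMonoidHom.id α.A) h (x C) = x D} := by
    simp only [Set.ofPred_forall]
    refine isClosed_iInter fun C => isClosed_iInter fun D => isClosed_iInter fun h => ?_
    exact isClosed_eq (continuous_of_discreteTopology.comp (continuous_apply C))
      (continuous_apply D)
  convert hT.inter_right hZ using 1
  ext x
  constructor
  · rintro ⟨y, hy, rfl⟩
    refine ⟨fun C _ => ?_, y.2⟩
    obtain ⟨a, ha, _, h⟩ := hy C.1 C.2
    exact ⟨a, ha, h.symm⟩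
  · rintro ⟨h1, h2⟩
    refine ⟨⟨x, h2⟩, fun C hC => ?_, rfl⟩
    obtain ⟨a, ha, h⟩ := h1 ⟨C, hC⟩ trivial
    exact ⟨a, ha, hC, h.symm⟩

end

/-! ### Translations and dilations -/

/-- The translation by an element of `A`. -/
def shift (α : AlgAct Γ V) (a : α.A) : α.affGrp :=
  ⟨SemidirectProduct.inl (Multiplicative.ofAdd (a : V)),
    ⟨1, α.S.one_mem, by simp⟩, α.grp.one_mem⟩

/-- The dilation by an element of `S`. -/
def dilation (α : AlgAct Γ V) (s : α.S) : α.affGrp :=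
  ⟨SemidirectProduct.inr (s : Γ), α.frac.zero_mem, Subgroup.subset_closure s.2⟩

section

variable {α : AlgAct Γ V}

theorem aff_shift (a : α.A) (x : V) : aff (α.shift a).1 x = a + x := by
  simp [aff, shift]

theorem aff_dilation (s : α.S) (x : V) : aff (α.dilation s).1 x = (s : Γ) • x := by
  simp [aff, dilation]

theorem shift_add (a b : α.A) : α.shift (a + b) = α.shift a * α.shift b := by
  apply Subtype.ext
  simp [shift]

theorem dilation_mul_shift (s : α.S) (a : α.A) :
    α.dilation s * α.shift a = α.shift (α.σ s a) * α.dilation s := by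
  apply Subtype.ext
  apply SemidirectProduct.ext
  · change 1 * Multiplicative.ofAdd ((s : Γ) • (a : V)) =
      Multiplicative.ofAdd ((s : Γ) • (a : V)) * Multiplicative.ofAdd ((1 : Γ) • (0 : V))
    simp
  · simp [shift, dilation]

/-- The translate of a point of `Ā` by an element of `A`. -/
def translate (a : α.A) (x : α.Completion) : α.Completion :=
  ⟨fun C => (a : α.A ⧸ C.1) + x.1 C, fun C D h => by rw [map_add, x.2 C D h]; rfl⟩

theorem Rep.translate {C : AddSubgroup α.A} {b : α.A} {x : α.Completion} (h : α.Rep C b x)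
    (a : α.A) : α.Rep C (a + b) (translate a x) := by
  obtain ⟨hC, h⟩ := h
  refine ⟨hC, ?_⟩
  simp only [AlgAct.translate, h]
  rfl

theorem ext_shift (a : α.A) (x : α.Completion) : α.Ext (α.shift a) x (translate a x) := by
  intro C hC
  obtain ⟨b, hb⟩ := exists_rep hC x
  exact ⟨b, a + b, (aff_shift _ _).symm, hb, hb.translate a⟩

theorem Agree.translate {C : AddSubgroup α.A} {x y : α.Completion} (h : α.Agree C x y)
    (a : α.A) : α.Agree C (translate a x) (AlgAct.translate a y) :=
  let ⟨b, h1, h2⟩ := h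
  ⟨a + b, h1.translate a, h2.translate a⟩

theorem translate_mem_closureSet {A₀ : AddSubgroup α.A} {a : α.A} (ha : a ∈ A₀)
    {x : α.Completion} (hx : x ∈ α.closureSet A₀) : translate a x ∈ α.closureSet A₀ := by
  intro C hC
  obtain ⟨b, hb, h⟩ := hx C hC
  exact ⟨a + b, A₀.add_mem ha hb, h.translate a⟩

theorem translate_embed (a b : α.A) : translate a (α.embed b) = α.embed (a + b) := rfl

end

/-! ### Cocycles -/

/-- A continuous cocycle on the partial transformation groupoid, with values in a discrete
group. -/
structure Cocycle (α : AlgAct Γ V) (G : Type*) [Group G] where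
  toFun : α.Arrow → G
  map_mul : ∀ {g h : α.affGrp} {x y z : α.Completion} (hh : α.Ext h x y) (hg : α.Ext g y z),
    toFun ⟨(g * h, x), z, hh.mul hg⟩ = toFun ⟨(g, y), z, hg⟩ * toFun ⟨(h, x), y, hh⟩
  locally_const : ∀ p : α.Arrow, ∃ C, α.Constructible C ∧ ∀ q : α.Arrow, q.1.1 = p.1.1 →
    α.Agree C p.1.2 q.1.2 → toFun q = toFun p

namespace Cocycle

variable {α : AlgAct Γ V} {G : Type*} [Group G] (c : α.Cocycle G)

/-- The value of a cocycle at the translation by `a` starting at `x`. -/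
def atShift (a : α.A) (x : α.Completion) : G := c.toFun ⟨(α.shift a, x), _, ext_shift a x⟩

/-- The value of a cocycle at the dilation by `s` starting at `a`. -/
def atDilation (s : α.S) (a : α.A) : G :=
  c.toFun ⟨(α.dilation s, α.embed a), _, ext_embed (b := α.σ s a) (aff_dilation s a).symm⟩

theorem toFun_congr {g h : α.affGrp} {x y : α.Completion} (hgh : g = h) (hxy : x = y)
    (h1 : ∃ z, α.Ext g x z) (h2 : ∃ z, α.Ext h y z) :
    c.toFun ⟨(g, x), h1⟩ = c.toFun ⟨(h, y), h2⟩ := by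
  subst hgh hxy
  rfl

theorem atShift_add (a b : α.A) (x : α.Completion) :
    c.atShift (a + b) x = c.atShift a (translate b x) * c.atShift b x := by
  refine Eq.trans ?_ (c.map_mul (ext_shift b x) (ext_shift a (translate b x)))
  exact c.toFun_congr (shift_add a b) rfl _ _

theorem atShift_zero (x : α.Completion) : c.atShift 0 x = 1 := by
  have h := c.atShift_add 0 0 x
  have : translate (0 : α.A) x = x := by
    apply Subtype.ext
    funext C
    simp [translate]
  rwa [this, add_zero, left_eq_mul] at h

/-- The arrow with group element `x ↦ s • (a + x)` and source `0` factors in two ways: translate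
then dilate, or dilate then translate by `σ_s a`. -/
theorem atDilation_mul_atShift (s : α.S) (a : α.A) :
    c.atDilation s a * c.atShift a (α.embed 0) =
      c.atShift (α.σ s a) (α.embed 0) * c.atDilation s 0 := by
  -- The composable arrows literally have targets `a + 0` and `σ_s 0`.
  have h1 : c.atDilation s a = c.atDilation s (a + 0) := by rw [add_zero]
  have h2 : c.atShift (α.σ s a) (α.embed 0) = c.atShift (α.σ s a) (α.embed (α.σ s 0)) := by
    rw [map_zero]
  rw [h1, h2]
  unfold atShift atDilation
  have e1 := c.map_mul (ext_shift a (α.embed 0))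
    (ext_embed (b := α.σ s (a + 0)) (aff_dilation s (a + 0 : α.A)).symm)
  have e2 := c.map_mul (ext_embed (b := α.σ s 0) (aff_dilation s (0 : α.A)).symm)
    (ext_shift (α.σ s a) (α.embed (α.σ s 0)))
  refine e1.symm.trans (Eq.trans ?_ e2)
  exact c.toFun_congr (dilation_mul_shift s a) rfl _ _

/-- Compactness gives a suitable `C` for each single `a`. Finite generation makes it uniform in `a ∈
A₀`: a `C` good for the generators is good for sums and negatives by the cocycle identity. -/
theorem exists_atShift_eq
    (hα : ∀ s : α.S, ∃ n : ℕ, 0 < n ∧ ∀ a, n • a ∈ (α.σ s).range) {A₀ : AddSubgroup α.A}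
    (hA₀ : A₀.FG) : ∃ C, α.Constructible C ∧ ∀ a ∈ A₀, ∀ x ∈ α.closureSet A₀,
      ∀ y ∈ α.closureSet A₀, α.Agree C x y → c.atShift a x = c.atShift a y := by
  classical
  have key : ∀ a, ∃ C, α.Constructible C ∧ ∀ x ∈ α.closureSet A₀,
      ∀ y, α.Agree C x y → c.atShift a x = c.atShift a y := by
    intro a
    have := fun x => c.locally_const ⟨(α.shift a, x), _, ext_shift a x⟩
    choose D hD hDc using this
    obtain ⟨t, -, ht⟩ := (isCompact_closureSet hα hA₀).elim_nhds_subcover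
      (fun x => {y | α.Agree (D x) x y})
      (fun x _ => (isOpen_agree x).mem_nhds (agree_refl (hD x) x))
    -- Agreement modulo the intersection keeps `x` and `y` in the same member of the finite
    -- subcover, where the cocycle is constant.
    refine ⟨t.inf D, .finset_inf _ _ fun x _ => hD x, fun x hx y hxy => ?_⟩
    obtain ⟨z, hz, h⟩ : ∃ z ∈ t, α.Agree (D z) z x := by simpa using ht hx
    have h' := h.trans (hxy.mono (hD z) (Finset.inf_le hz))
    exact (hDc z ⟨(α.shift a, x), _, ext_shift a x⟩ rfl h).trans
      (hDc z ⟨(α.shift a, y), _, ext_shift a y⟩ rfl h').symm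
  choose D hD hDc using key
  obtain ⟨E, rfl⟩ := hA₀
  refine ⟨E.inf D, .finset_inf _ _ fun x _ => hD x, fun a ha => ?_⟩
  induction ha using AddSubgroup.closure_induction with
  | mem a ha =>
    exact fun x hx y _ hxy => hDc a x hx y (hxy.mono (hD a) (Finset.inf_le ha))
  | zero => intros; rw [atShift_zero, atShift_zero]
  | add a b _ hb iha ihb =>
    -- Translation by `b` preserves the closure of `A₀` and agreement modulo `C`, so the same `C`
    -- serves for `a + b`.
    intro x hx y hy hxy
    rw [atShift_add, atShift_add, ihb x hx y hy hxy,
      iha _ (translate_mem_closureSet hb hx) _ (translate_mem_closureSet hb hy) (hxy.translate b)]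
  | neg a ha ih =>
    have hneg : ∀ x, c.atShift (-a) x = (c.atShift a (translate (-a) x))⁻¹ := by
      intro x
      have h := c.atShift_add a (-a) x
      rw [add_neg_cancel, atShift_zero] at h
      exact (inv_eq_of_mul_eq_one_right h.symm).symm
    intro x hx y hy hxy
    have ha' := neg_mem ha
    rw [hneg, hneg, ih _ (translate_mem_closureSet ha' hx) _ (translate_mem_closureSet ha' hy)
      (hxy.translate _)]

theorem exists_atDilation_eq (s : α.S) : ∃ C, α.Constructible C ∧
    ∀ a ∈ C, c.atDilation s a = c.atDilation s 0 := by
  obtain ⟨C, hC, h⟩ := c.locally_const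
    ⟨(α.dilation s, α.embed 0), _, ext_embed (b := α.σ s 0) (aff_dilation s (0 : α.A)).symm⟩
  exact ⟨C, hC, fun a ha => h _ rfl (agree_embed hC (by simpa using ha))⟩

end Cocycle

end AlgAct

/-- The inverse isomorphism. -/
def TopGroupoid.Iso.symm {X Y : TopGroupoid} (I : TopGroupoid.Iso X Y) : TopGroupoid.Iso Y X where
  obj := I.obj.symm
  arr := I.arr.symm
  map_src a := by
    rw [Homeomorph.eq_symm_apply, ← I.map_src, Homeomorph.apply_symm_apply]
  map_tgt a := by
    rw [Homeomorph.eq_symm_apply, ← I.map_tgt, Homeomorph.apply_symm_apply]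
  map_mul a b h := by
    rw [Homeomorph.symm_apply_eq, I.map_mul]
    congr 1 <;> rw [Homeomorph.apply_symm_apply]

namespace AlgAct

variable {Γ V : Type*} [Group Γ] [AddCommGroup V] [DistribMulAction Γ V]
  {Γ' V' : Type*} [Group Γ'] [AddCommGroup V'] [DistribMulAction Γ' V']

/-! ### From groupoid isomorphisms to linear maps -/

theorem exists_agree_subset_arrow {α : AlgAct Γ V} {U : Set α.Arrow} (hU : IsOpen U) {p : α.Arrow}
    (hp : p ∈ U) : ∃ C, α.Constructible C ∧ ∀ q : α.Arrow, q.1.1 = p.1.1 →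
      α.Agree C p.1.2 q.1.2 → q ∈ U := by
  let : TopologicalSpace α.affGrp := ⊥
  obtain ⟨W, hW, rfl⟩ := isOpen_induced_iff.1 hU
  have hW' : IsOpen ((fun y : α.Completion => (p.1.1, y)) ⁻¹' W) :=
    hW.preimage (Continuous.prodMk_right p.1.1)
  obtain ⟨C, hC, h⟩ := exists_agree_subset hW' (x := p.1.2) hp
  refine ⟨C, hC, fun q hq hpq => ?_⟩
  have := h _ hpq
  rw [← hq] at this
  exact this

/-- The cocycle of an isomorphism of groupoids. -/
noncomputable def cocycleOfIso {α : AlgAct Γ V} {β : AlgAct Γ' V'}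
    (I : TopGroupoid.Iso α.groupoid β.groupoid) :
    α.Cocycle β.affGrp where
  toFun p := (show β.Arrow from I.arr p).1.1
  map_mul {g h x y z} hh hg := by
    have e : Arrow.tgt (α := α) ⟨(h, x), y, hh⟩ = y := Arrow.tgt_eq (α := α) ⟨(h, x), y, hh⟩ hh
    exact congrArg (fun q : β.Arrow => q.1.1)
      (I.map_mul (⟨(g, y), z, hg⟩ : α.Arrow) (⟨(h, x), y, hh⟩ : α.Arrow) e.symm)
  locally_const p := by
    let : TopologicalSpace β.affGrp := ⊥
    have : DiscreteTopology β.affGrp := ⟨rfl⟩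
    have hc : Continuous fun q : α.Arrow => (show β.Arrow from I.arr q).1.1 :=
      Arrow.continuous_grp.comp I.arr.continuous
    exact exists_agree_subset_arrow
      ((isOpen_discrete {(show β.Arrow from I.arr p).1.1}).preimage hc) rfl

/-- An arrow of the target groupoid is a pair of group element and source. Equal cocycle values at
equal sources therefore force equal arrows, and a translation is recovered from its value at `0`. -/
theorem eq_zero_of_atShift_eq_one {α : AlgAct Γ V} {β : AlgAct Γ' V'}
    (I : TopGroupoid.Iso α.groupoid β.groupoid) {a : α.A} {x : α.Completion}
    (h : (cocycleOfIso I).atShift a x = 1) : a = 0 := by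
  have h0 := (cocycleOfIso I).atShift_zero x
  have key : ∀ p q : α.Arrow, (cocycleOfIso I).toFun p = (cocycleOfIso I).toFun q →
      p.1.2 = q.1.2 → p = q := by
    intro p q hpq e
    apply I.arr.injective
    refine Subtype.ext (Prod.ext hpq ?_)
    exact (I.map_src p).trans ((congrArg I.obj e).trans (I.map_src q).symm)
  have e := congrArg (fun p : α.Arrow => aff p.1.1.1 (0 : V)) (key _ _ (h.trans h0.symm) rfl)
  change aff (α.shift a).1 0 = aff (α.shift 0).1 0 at e
  rw [aff_shift, aff_shift] at e
  simpa using e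

theorem isLarge_map_of_constructible {α : AlgAct Γ V} (hA : α.A.IsLarge)
    (hα : ∀ s : α.S, ∃ n : ℕ, 0 < n ∧ ∀ a, n • a ∈ (α.σ s).range) {C : AddSubgroup α.A}
    (hC : α.Constructible C) : (C.map α.A.subtype).IsLarge := by
  intro v
  obtain ⟨m, hm, h⟩ := exists_nsmul_mem_of_constructible hα hC
  obtain ⟨n, hn, h'⟩ := hA v
  exact ⟨m * n, mul_pos hm hn, _, h ⟨_, h'⟩, by simp [mul_smul]⟩

theorem grp_comm (α : AlgAct Γ V) {γ δ : Γ} (hγ : γ ∈ α.grp) (hδ : δ ∈ α.grp) :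
    γ * δ = δ * γ := by
  have : IsMulCommutative α.grp :=
    Subgroup.isMulCommutative_closure fun s hs t ht => α.comm s hs t ht
  exact congrArg Subtype.val (mul_comm' (⟨γ, hγ⟩ : α.grp) ⟨δ, hδ⟩)

/-- `F` extends the translation part of the cocycle on those small translations whose image is a
pure translation. The hypothesis `hfix` ensures that there are enough of them. -/
theorem exists_linearMap_of_iso {α : AlgAct Γ V} {β : AlgAct Γ' V'} [Module ℚ V]
    [Module.Finite ℚ V] [Module ℚ V'] (I : TopGroupoid.Iso α.groupoid β.groupoid)
    (hA : α.A.IsLarge) (hα : ∀ s : α.S, ∃ n : ℕ, 0 < n ∧ ∀ a, n • a ∈ (α.σ s).range)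
    (hfix : ∃ s ∈ α.S, ∀ v : V, ∃ w, v = w - s • w) :
    ∃ F : V →ₗ[ℚ] V', Function.Injective F ∧
      ∀ s ∈ α.S, ∃ γ ∈ β.grp, ∀ x, F (s • x) = γ • F x := by
  set c := cocycleOfIso I
  -- `A` need not be finitely generated, so the compactness argument is applied to a finitely
  -- generated subgroup that still has full rank.
  obtain ⟨A₁, hfg, hle, hlarge⟩ := hA.exists_fg
  let A₀ := A₁.addSubgroupOf α.A
  have hA₀ : A₀.FG := by
    rw [← AddGroup.fg_iff_addSubgroup_fg] at hfg ⊢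
    exact AddGroup.fg_of_surjective
      (f := (AddSubgroup.addSubgroupOfEquivOfLe hle).symm.toAddMonoidHom)
      (AddSubgroup.addSubgroupOfEquivOfLe hle).symm.surjective
  have hA₀' : (A₀.map α.A.subtype).IsLarge := by
    intro v
    obtain ⟨n, hn, h⟩ := hlarge v
    exact ⟨n, hn, ⟨_, hle h⟩, h, rfl⟩
  obtain ⟨C, hC, hconst⟩ := c.exists_atShift_eq hα hA₀
  let h : α.A → β.affGrp := fun a => c.atShift a (α.embed 0)
  let T := A₀ ⊓ C
  have hT : (T.map α.A.subtype).IsLarge := by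
    rw [AddSubgroup.map_inf _ _ _ α.A.subtype_injective]
    exact hA₀'.inf (isLarge_map_of_constructible hA hα hC)
  have h_add : ∀ a ∈ T, ∀ b ∈ T, h (a + b) = h a * h b := by
    intro a ha b hb
    change c.atShift _ _ = c.atShift _ _ * _
    rw [c.atShift_add, translate_embed, add_zero]
    congr 1
    -- Since `b ∈ C`, the base points `b` and `0` agree modulo `C`.
    exact hconst a ha.1 _ (embed_mem_closureSet hb.1) _ (embed_mem_closureSet A₀.zero_mem)
      (agree_embed hC (by simpa using C.neg_mem hb.2))
  have h_zero : h 0 = 1 := c.atShift_zero _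
  have h_neg : ∀ a ∈ T, h (-a) = (h a)⁻¹ := by
    intro a ha
    rw [eq_comm, inv_eq_iff_mul_eq_one, ← h_add a ha _ (T.neg_mem ha), add_neg_cancel, h_zero]
  -- On `B` the values of `h` are pure translations, so their translation parts add.
  let B : AddSubgroup α.A :=
    { carrier := {a | a ∈ T ∧ (h a).1.right = 1}
      zero_mem' := ⟨T.zero_mem, by rw [h_zero]; rfl⟩
      add_mem' := by
        rintro a b ⟨ha, ha'⟩ ⟨hb, hb'⟩
        refine ⟨T.add_mem ha hb, ?_⟩
        rw [h_add a ha b hb, Subgroup.coe_mul, SemidirectProduct.mul_right, ha', hb', mul_one]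
      neg_mem' := by
        rintro a ⟨ha, ha'⟩
        refine ⟨T.neg_mem ha, ?_⟩
        rw [h_neg a ha, Subgroup.coe_inv, SemidirectProduct.inv_right, ha', inv_one] }
  let f : B →+ V' :=
    { toFun := fun b => (h b.1).1.left.toAdd
      map_zero' := by
        change (h 0).1.left.toAdd = 0
        rw [h_zero]; rfl
      map_add' := by
        rintro ⟨a, ha, ha'⟩ ⟨b, hb, hb'⟩
        change (h (a + b)).1.left.toAdd = _
        rw [h_add a ha b hb]
        change (h a).1.left.toAdd + (h a).1.right • (h b).1.left.toAdd =
          (h a).1.left.toAdd + (h b).1.left.toAdd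
        rw [ha', one_smul] }
  have h_comm : ∀ s : α.S, ∃ D, α.Constructible D ∧ ∀ a ∈ D,
      c.atDilation s 0 * h a = h (α.σ s a) * c.atDilation s 0 := by
    intro s
    obtain ⟨D, hD, hD'⟩ := c.exists_atDilation_eq s
    refine ⟨D, hD, fun a ha => ?_⟩
    have := c.atDilation_mul_atShift s a
    rwa [hD' a ha] at this
  have h_right : ∀ (s : α.S) (a : α.A),
      c.atDilation s 0 * h a = h (α.σ s a) * c.atDilation s 0 →
      (h (α.σ s a)).1.right = (h a).1.right := by
    intro s a e
    have := congrArg (fun g : β.affGrp => g.1.right) e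
    simp only [Subgroup.coe_mul, SemidirectProduct.mul_right] at this
    -- The linear parts commute, so conjugation by the image of the dilation leaves the linear part
    -- of `h a` unchanged.
    rw [β.grp_comm (h (α.σ s a)).2.2 (c.atDilation s 0).2.2] at this
    exact (mul_left_cancel this).symm
  have key : ∀ s : α.S, ∃ D : AddSubgroup α.A, (D.map α.A.subtype).IsLarge ∧ ∀ a ∈ D, a ∈ T ∧
      α.σ s a ∈ T ∧ c.atDilation s 0 * h a = h (α.σ s a) * c.atDilation s 0 := by
    intro s
    obtain ⟨D, hD, hD'⟩ := h_comm s
    refine ⟨T ⊓ D ⊓ T.comap (α.σ s), ?_, fun a ha => ⟨ha.1.1, ha.2, hD' a ha.1.2⟩⟩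
    -- Largeness is checked in `V`, where the preimage of the large subgroup `T` under `s` is again
    -- large.
    intro v
    obtain ⟨n, hn, ⟨⟨a, ha, e1⟩, ⟨a', ha', e2⟩⟩, ⟨b, hb, e3⟩⟩ :=
      ((hT.inf (isLarge_map_of_constructible hA hα hD)).inf
        (hT.comap (DistribSMul.toAddMonoidHom V (s : Γ)))) v
    obtain rfl : a = a' := Subtype.ext (e1.trans e2.symm)
    refine ⟨n, hn, a, ⟨⟨ha, ha'⟩, ?_⟩, e1⟩
    have : α.σ s a = b := Subtype.ext (by
      rw [show (b : V) = (s : Γ) • (n • v) from e3, ← e1]; rfl)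
    change α.σ s a ∈ T
    rw [this]
    exact hb
  have hB : (B.map α.A.subtype).IsLarge := by
    -- Every vector is `w - s • w`. For a multiple `a` of `w` in `D`, the linear parts of `h a` and
    -- `h (σ_s a)` cancel, so `a - σ_s a ∈ B`.
    obtain ⟨s, hs, hs'⟩ := hfix
    obtain ⟨D, hD, hD'⟩ := key ⟨s, hs⟩
    intro v
    obtain ⟨w, rfl⟩ := hs' v
    obtain ⟨n, hn, a, ha, e⟩ := hD w
    obtain ⟨h1, h2, h3⟩ := hD' a ha
    refine ⟨n, hn, a - α.σ ⟨s, hs⟩ a, ⟨T.sub_mem h1 h2, ?_⟩, ?_⟩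
    · rw [sub_eq_add_neg, h_add _ h1 _ (T.neg_mem h2), h_neg _ h2, Subgroup.coe_mul,
        Subgroup.coe_inv, SemidirectProduct.mul_right, SemidirectProduct.inv_right,
        h_right _ _ h3, mul_inv_cancel]
    · rw [map_sub, e, smul_sub, smul_comm n s, ← e]
      rfl
  obtain ⟨F, hF⟩ := AddSubgroup.IsLarge.exists_linearMap_extension
    (i := α.A.subtype.comp B.subtype)
    (α.A.subtype_injective.comp B.subtype_injective) f
  have hF' : ∀ a (_ : a ∈ B), F (a : V) = (h a).1.left.toAdd := fun a ha => hF ⟨a, ha⟩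
  have : IsAddTorsionFree V' := .of_module_rat V'
  have : IsAddTorsionFree V := .of_module_rat V
  refine ⟨F, ?_, ?_⟩
  · rw [injective_iff_map_eq_zero]
    intro v hv
    obtain ⟨n, hn, a, ha, e⟩ := hB v
    have h1 : F (a : V) = 0 := by
      rw [show (a : V) = n • v from e, map_nsmul, hv, smul_zero]
    rw [hF' a ha] at h1
    have h2 : h a = 1 := Subtype.ext (SemidirectProduct.ext h1 ha.2)
    have h3 : a = 0 := eq_zero_of_atShift_eq_one I h2
    rw [h3, map_zero] at e
    exact (nsmul_eq_zero_iff_right hn.ne').1 e.symm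
  · intro s hs
    refine ⟨(c.atDilation ⟨s, hs⟩ 0).1.right, (c.atDilation ⟨s, hs⟩ 0).2.2, fun x => ?_⟩
    obtain ⟨D, hD, hD'⟩ := key ⟨s, hs⟩
    -- Two additive maps into a torsion-free group that agree on a subgroup of full rank are equal.
    refine DFunLike.congr_fun ((hB.inf hD).eq_of_eqOn
      (f := F.toAddMonoidHom.comp (DistribSMul.toAddMonoidHom V s))
      (g := (DistribSMul.toAddMonoidHom V' _).comp F.toAddMonoidHom) ?_) x
    rintro _ ⟨⟨a, ha, rfl⟩, ⟨a', ha', e⟩⟩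
    obtain rfl : a' = a := Subtype.ext e
    obtain ⟨h1, h2, h3⟩ := hD' a' ha'
    have h4 : α.σ ⟨s, hs⟩ a' ∈ B := ⟨h2, (h_right _ _ h3).trans ha.2⟩
    have e1 := hF' _ h4
    have e2 := hF' _ ha
    have e3 := congrArg (fun g : β.affGrp => g.1.left.toAdd) h3
    change F (s • (a' : V)) = _ at e1
    change F (s • (a' : V)) = (c.atDilation ⟨s, hs⟩ 0).1.right • F (a' : V)
    rw [e1, e2]
    change (c.atDilation ⟨s, hs⟩ 0).1.left.toAdd +
      (c.atDilation ⟨s, hs⟩ 0).1.right • (h a').1.left.toAdd =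
      (h (α.σ ⟨s, hs⟩ a')).1.left.toAdd +
      (h (α.σ ⟨s, hs⟩ a')).1.right • (c.atDilation ⟨s, hs⟩ 0).1.left.toAdd at e3
    -- As `h (σ_s a')` has trivial linear part, the translation part of the image of the dilation
    -- occurs on both sides and cancels.
    rw [h4.2, one_smul, add_comm] at e3
    exact (add_right_cancel e3).symm

end AlgAct

namespace AlgAct

/-! ### Transport of structure -/

/-- An isomorphism of algebraic actions that is compatible with the ambient group actions. -/
structure AmbientIso {Γ V Γ' V' : Type*} [Group Γ] [AddCommGroup V] [DistribMulAction Γ V]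
    [Group Γ'] [AddCommGroup V'] [DistribMulAction Γ' V'] (α : AlgAct Γ V)
    (β : AlgAct Γ' V') where
  grpEquiv : Γ ≃* Γ'
  addEquiv : V ≃+ V'
  map_smul : ∀ γ x, addEquiv (γ • x) = grpEquiv γ • addEquiv x
  map_mem_S : ∀ γ, γ ∈ α.S → grpEquiv γ ∈ β.S
  symm_mem_S : ∀ γ, γ ∈ β.S → grpEquiv.symm γ ∈ α.S
  map_mem_A : ∀ x, x ∈ α.A → addEquiv x ∈ β.A
  symm_mem_A : ∀ x, x ∈ β.A → addEquiv.symm x ∈ α.A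

namespace AmbientIso

variable {Γ V Γ' V' : Type*} [Group Γ] [AddCommGroup V] [DistribMulAction Γ V]
    [Group Γ'] [AddCommGroup V'] [DistribMulAction Γ' V'] {α : AlgAct Γ V}
    {β : AlgAct Γ' V'} (e : AmbientIso α β)

/-- The inverse isomorphism. -/
def symm : AmbientIso β α where
  grpEquiv := e.grpEquiv.symm
  addEquiv := e.addEquiv.symm
  map_smul γ x := by
    rw [AddEquiv.symm_apply_eq, e.map_smul, MulEquiv.apply_symm_apply, AddEquiv.apply_symm_apply]
  map_mem_S := e.symm_mem_S
  symm_mem_S := e.map_mem_S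
  map_mem_A := e.symm_mem_A
  symm_mem_A := e.map_mem_A

/-- The induced map between the groups acted upon. -/
def toA : α.A →+ β.A where
  toFun a := ⟨e.addEquiv a, e.map_mem_A a a.2⟩
  map_zero' := Subtype.ext (map_zero e.addEquiv)
  map_add' a b := Subtype.ext (map_add e.addEquiv (a : V) (b : V))

theorem symm_toA (a : α.A) : e.symm.toA (e.toA a) = a :=
  Subtype.ext (e.addEquiv.symm_apply_apply a)

theorem toA_symm (a : β.A) : e.toA (e.symm.toA a) = a :=
  Subtype.ext (e.addEquiv.apply_symm_apply a)

/-- The induced map between the monoids. -/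
def toS (s : α.S) : β.S := ⟨e.grpEquiv s, e.map_mem_S s s.2⟩

theorem toS_symm (s : β.S) : e.toS (e.symm.toS s) = s :=
  Subtype.ext (e.grpEquiv.apply_symm_apply s)

theorem toA_σ (s : α.S) (a : α.A) : e.toA (α.σ s a) = β.σ (e.toS s) (e.toA a) :=
  Subtype.ext (e.map_smul s a)

/-- Because `e` is bijective and intertwines the actions, pulling back commutes with images as well
as with preimages. -/
theorem constructible_comap {C : AddSubgroup β.A} (hC : β.Constructible C) :
    α.Constructible (C.comap e.toA) := by
  induction hC with
  | top => exact .top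
  | map s C _ ih =>
    have : (C.map (β.σ s)).comap e.toA = (C.comap e.toA).map (α.σ (e.symm.toS s)) := by
      ext x
      constructor
      · rintro ⟨y, hy, h⟩
        refine ⟨e.symm.toA y, ?_, ?_⟩
        · change e.toA (e.symm.toA y) ∈ C
          rwa [toA_symm]
        · rw [← e.symm.toA_σ, h, symm_toA]
      · rintro ⟨y, hy, rfl⟩
        exact ⟨e.toA y, hy, by rw [toA_σ, toS_symm]⟩
    rw [this]
    exact .map _ _ ih
  | comap s C _ ih =>
    have : (C.comap (β.σ s)).comap e.toA = (C.comap e.toA).comap (α.σ (e.symm.toS s)) := by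
      ext x
      simp only [AddSubgroup.mem_comap, toA_σ, toS_symm]
    rw [this]
    exact .comap _ _ ih

/-- The induced map between the completions. -/
def toCompletion (x : α.Completion) : β.Completion :=
  ⟨fun C => QuotientAddGroup.map (C.1.comap e.toA) C.1 e.toA le_rfl
      (x.1 ⟨C.1.comap e.toA, e.constructible_comap C.2⟩), fun C D h => by
    obtain ⟨a, ha⟩ := exists_rep (e.constructible_comap C.2) x
    obtain ⟨_, h2⟩ := ha.mono (e.constructible_comap D.2) (AddSubgroup.comap_mono h)
    obtain ⟨_, h1⟩ := ha
    simp only [h1, h2]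
    rfl⟩

theorem rep_toCompletion {C : AddSubgroup β.A} (hC : β.Constructible C) {a : α.A}
    {x : α.Completion} (h : α.Rep (C.comap e.toA) a x) :
    β.Rep C (e.toA a) (e.toCompletion x) := by
  obtain ⟨_, h⟩ := h
  refine ⟨hC, ?_⟩
  simp only [toCompletion, h]
  rfl

theorem symm_toCompletion (x : α.Completion) : e.symm.toCompletion (e.toCompletion x) = x := by
  refine completion_ext fun C hC => ?_
  obtain ⟨a, ha⟩ := exists_rep hC x
  have hC' : (C.comap e.symm.toA).comap e.toA = C := by
    ext y
    simp only [AddSubgroup.mem_comap, symm_toA]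
  have h := e.symm.rep_toCompletion hC (e.rep_toCompletion (e.symm.constructible_comap hC)
    (hC'.symm ▸ ha))
  rw [symm_toA] at h
  exact ⟨a, h, ha⟩

theorem continuous_toCompletion : Continuous e.toCompletion := by
  refine Arrow.continuous_completion fun C b => ?_
  rw [isOpen_iff_mem_nhds]
  intro x hx
  obtain ⟨hC, -⟩ := id hx
  have hC' := e.constructible_comap hC
  refine Filter.mem_of_superset
    ((isOpen_agree (C := C.comap e.toA) x).mem_nhds (agree_refl hC' x)) ?_
  rintro y ⟨a, h1, h2⟩
  exact (e.rep_toCompletion hC h2).congr ((e.rep_toCompletion hC h1).sub_mem hx)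

theorem grpEquiv_mem_grp {γ : Γ} (h : γ ∈ α.grp) : e.grpEquiv γ ∈ β.grp := by
  have : α.grp ≤ β.grp.comap e.grpEquiv.toMonoidHom :=
    (Subgroup.closure_le _).2 fun s hs => Subgroup.subset_closure (e.map_mem_S s hs)
  exact this h

/-- The induced map between the affine groups. -/
def toAff : α.affGrp →* β.affGrp where
  toFun g := ⟨⟨Multiplicative.ofAdd (e.addEquiv g.1.left.toAdd), e.grpEquiv g.1.right⟩, by
    obtain ⟨⟨s, hs, h⟩, hg⟩ := g.2
    refine ⟨⟨e.grpEquiv s, e.map_mem_S s hs, ?_⟩, e.grpEquiv_mem_grp hg⟩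
    change e.grpEquiv s • e.addEquiv g.1.left.toAdd ∈ β.A
    rw [← e.map_smul]
    exact e.map_mem_A _ h⟩
  map_one' := Subtype.ext (SemidirectProduct.ext (map_zero e.addEquiv) (map_one e.grpEquiv))
  map_mul' g h := by
    refine Subtype.ext (SemidirectProduct.ext ?_ (map_mul e.grpEquiv _ _))
    change e.addEquiv (g.1.left.toAdd + g.1.right • h.1.left.toAdd) =
      e.addEquiv g.1.left.toAdd + e.grpEquiv g.1.right • e.addEquiv h.1.left.toAdd
    rw [map_add, e.map_smul]

theorem symm_toAff (g : α.affGrp) : e.symm.toAff (e.toAff g) = g :=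
  Subtype.ext (SemidirectProduct.ext (e.addEquiv.symm_apply_apply _)
    (e.grpEquiv.symm_apply_apply _))

theorem aff_toAff (g : α.affGrp) (x : V) : aff (e.toAff g).1 (e.addEquiv x) =
    e.addEquiv (aff g.1 x) := by
  change e.addEquiv g.1.left.toAdd + e.grpEquiv g.1.right • e.addEquiv x = _
  rw [← e.map_smul, ← map_add]
  rfl

theorem ext_toAff {g : α.affGrp} {x y : α.Completion} (h : α.Ext g x y) :
    β.Ext (e.toAff g) (e.toCompletion x) (e.toCompletion y) := by
  intro C hC
  obtain ⟨a, b, hab, h1, h2⟩ := h _ (e.constructible_comap hC)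
  refine ⟨e.toA a, e.toA b, ?_, e.rep_toCompletion hC h1, e.rep_toCompletion hC h2⟩
  exact (congrArg e.addEquiv hab).trans (e.aff_toAff g a).symm

/-- The induced map between the sets of arrows. -/
def toArrow (p : α.Arrow) : β.Arrow :=
  ⟨(e.toAff p.1.1, e.toCompletion p.1.2), 
    _, e.ext_toAff (Arrow.tgt_spec p)⟩

theorem symm_toArrow (p : α.Arrow) : e.symm.toArrow (e.toArrow p) = p :=
  Subtype.ext (Prod.ext (e.symm_toAff _) (e.symm_toCompletion _))

theorem continuous_toArrow : Continuous e.toArrow := by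
  let : TopologicalSpace α.affGrp := ⊥
  let : TopologicalSpace β.affGrp := ⊥
  have : DiscreteTopology α.affGrp := ⟨rfl⟩
  exact Arrow.continuous_iff.2 ⟨(continuous_of_discreteTopology (f := e.toAff)).comp
    Arrow.continuous_grp, e.continuous_toCompletion.comp Arrow.continuous_src⟩

/-- The induced isomorphism of groupoids. -/
noncomputable def groupoidIso : TopGroupoid.Iso α.groupoid β.groupoid where
  obj :=
    { toFun := e.toCompletion
      invFun := e.symm.toCompletion
      left_inv := e.symm_toCompletion
      right_inv := e.symm.symm_toCompletion
      continuous_toFun := e.continuous_toCompletion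
      continuous_invFun := e.symm.continuous_toCompletion }
  arr :=
    { toFun := e.toArrow
      invFun := e.symm.toArrow
      left_inv := e.symm_toArrow
      right_inv := e.symm.symm_toArrow
      continuous_toFun := e.continuous_toArrow
      continuous_invFun := e.symm.continuous_toArrow }
  map_src _ := rfl
  map_tgt p := Arrow.tgt_eq (e.toArrow p) (e.ext_toAff (Arrow.tgt_spec p))
  map_mul p q _ := Subtype.ext (Prod.ext (map_mul e.toAff p.1.1 q.1.1) rfl)

end AmbientIso

end AlgAct

/-! ### Algebra isomorphisms from semilinear maps -/

/-- A linear bijection that intertwines the left multiplications by a spanning set with left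
multiplications is semilinear with respect to an algebra isomorphism. -/
theorem LinearEquiv.exists_algEquiv {K A B : Type*} [Field K] [Ring A] [Ring B] [Algebra K A]
    [Algebra K B] [Module.Finite K A] (F : A ≃ₗ[K] B) {S : Set A} (hS : Submodule.span K S = ⊤)
    (h : ∀ s ∈ S, ∃ w : B, ∀ x, F (s * x) = w * F x) :
    ∃ φ : A ≃ₐ[K] B, ∀ r x, F (r * x) = φ r * F x := by
  have h1 : ∀ r, ∃ w : B, ∀ x, F (r * x) = w * F x := by
    intro r
    have hr : r ∈ Submodule.span K S := hS ▸ Submodule.mem_top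
    induction hr using Submodule.span_induction with
    | mem s hs => exact h s hs
    | zero => exact ⟨0, fun x => by simp⟩
    | add r s _ _ hr hs =>
      obtain ⟨v, hv⟩ := hr
      obtain ⟨w, hw⟩ := hs
      exact ⟨v + w, fun x => by rw [add_mul, map_add, hv, hw, add_mul]⟩
    | smul q r _ hr =>
      obtain ⟨w, hw⟩ := hr
      exact ⟨q • w, fun x => by rw [smul_mul_assoc, map_smul, hw, smul_mul_assoc]⟩
  -- The multiplier of `r` is forced: evaluate the intertwining relation at `x = F⁻¹ 1`.
  let f : A →ₗ[K] B := F.toLinearMap ∘ₗ LinearMap.mulRight K (F.symm 1)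
  have hf : ∀ r x, F (r * x) = f r * F x := by
    intro r x
    obtain ⟨w, hw⟩ := h1 r
    have : f r = w := (hw (F.symm 1)).trans (by rw [F.apply_symm_apply, mul_one])
    rw [this, hw]
  have hf1 : f 1 = 1 := by simp [f]
  let φ : A →ₐ[K] B := AlgHom.ofLinearMap f hf1 fun r s => by
    change F (r * s * _) = _
    rw [mul_assoc, hf]
    rfl
  have hinj : Function.Injective φ := by
    rw [injective_iff_map_eq_zero]
    intro r hr
    have h2 := hf r 1
    rw [mul_one, show f r = 0 from hr, zero_mul] at h2
    simpa using h2
  have : Module.Finite K B := Module.Finite.equiv F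
  have hsurj : Function.Surjective φ :=
    (LinearMap.injective_iff_surjective_of_finrank_eq_finrank F.finrank_eq (f := f)).1 hinj
  exact ⟨AlgEquiv.ofBijective φ ⟨hinj, hsurj⟩, hf⟩

namespace QR

variable {R : Type*} [Ring R]

/-! ### The algebra `ℚR` -/

theorem ι_injective [Module.Finite ℤ R] [IsAddTorsionFree R] :
    Function.Injective (ι : R →+* QR R) := by
  have : Module.Flat ℤ R := inferInstance
  exact Algebra.TensorProduct.includeRight_injective (algebraMap ℤ ℚ).injective_int

theorem span_range_ι : Submodule.span ℚ (Set.range (ι : R →+* QR R)) = ⊤ := by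
  rw [eq_top_iff]
  intro x _
  induction x using TensorProduct.induction_on with
  | zero => exact Submodule.zero_mem _
  | add x y hx hy => exact Submodule.add_mem _ (hx trivial) (hy trivial)
  | tmul q r =>
    have : q ⊗ₜ[ℤ] r = q • (ι r : QR R) := by simp [ι, TensorProduct.smul_tmul']
    rw [this]
    exact Submodule.smul_mem _ _ (Submodule.subset_span ⟨r, rfl⟩)

theorem isLarge_map_closure {M : Submonoid R}
    (h : (AddSubgroup.closure (M : Set R)).FiniteIndex) :
    ((AddSubgroup.closure (M : Set R)).map (ι : R →+* QR R).toAddMonoidHom).IsLarge := by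
  intro v
  obtain ⟨m, hm, r, hr⟩ : ∃ m : ℕ, 0 < m ∧ m • v ∈ (ι : R →+* QR R).toAddMonoidHom.range :=
    AddSubgroup.IsLarge.of_span_eq_top (B := (ι : R →+* QR R).toAddMonoidHom.range)
      span_range_ι v
  -- The factor `m` clears denominators into `R`; the index then moves the result into the span of
  -- `M`.
  refine ⟨(AddSubgroup.closure (M : Set R)).index * m,
    mul_pos (Nat.pos_of_ne_zero h.index_ne_zero) hm, _ • r,
    AddSubgroup.nsmul_index_mem _ r, ?_⟩
  rw [map_nsmul, hr, mul_smul]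

theorem span_image_ι {M : Submonoid R} (h : (AddSubgroup.closure (M : Set R)).FiniteIndex) :
    Submodule.span ℚ (ι '' (M : Set R)) = (⊤ : Submodule ℚ (QR R)) := by
  rw [eq_top_iff, ← (isLarge_map_closure h).span_eq_top, Submodule.span_le]
  rintro _ ⟨r, hr, rfl⟩
  induction hr using AddSubgroup.closure_induction with
  | mem r hr => exact Submodule.subset_span ⟨r, hr, rfl⟩
  | zero => rw [map_zero]; exact Submodule.zero_mem _
  | add r s _ _ hr hs => rw [map_add]; exact Submodule.add_mem _ hr hs
  | neg r _ hr => rw [map_neg]; exact Submodule.neg_mem _ hr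

theorem closure_mul_mem {M : Submonoid R} {L : AddSubgroup (QR R)}
    (hL : ∀ a ∈ M, ∀ x ∈ L, ι a * x ∈ L) {r : R} (hr : r ∈ AddSubgroup.closure (M : Set R))
    {x : QR R} (hx : x ∈ L) : ι r * x ∈ L := by
  induction hr using AddSubgroup.closure_induction with
  | mem r hr => exact hL r hr x hx
  | zero => rw [map_zero, zero_mul]; exact L.zero_mem
  | add r s _ _ hr hs => rw [map_add, add_mul]; exact L.add_mem hr hs
  | neg r _ hr =>
    have : ι (-r) * x = -(ι r * x) := by rw [map_neg]; exact neg_mul (ι r : QR R) x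
    rw [this]
    exact L.neg_mem hr

theorem isIntegral_ι [Module.Finite ℤ R] (r : R) : IsIntegral ℤ (ι r : QR R) :=
  map_isIntegral_int ι (IsIntegral.of_finite ℤ r)

theorem isIntegral_map {S : Type*} [Ring S] (φ : QR R ≃ₐ[ℚ] QR S) {x : QR R}
    (hx : IsIntegral ℤ x) : IsIntegral ℤ (φ x) :=
  map_isIntegral_int φ hx

theorem exists_mem_units [Module.Finite ℤ R] {M : Submonoid R} (hreg : ∀ a ∈ M, IsLeftRegular a)
    {a : R} (ha : a ∈ M) : ∃ u ∈ units M, (u : QR R) = ι a := by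
  obtain ⟨u, hu⟩ := isUnit_ι (hreg a ha)
  exact ⟨u, ⟨a, ha, hu.symm⟩, hu⟩

section

variable {M : Submonoid R} {L : AddSubgroup (QR R)} (hM : ∀ a ∈ M, ∀ b ∈ M, a * b = b * a)
  (hL : ∀ a ∈ M, ∀ x ∈ L, ι a * x ∈ L)

/-- Some `n • s⁻¹` lies in the span of `M`, which preserves `L`; hence `n • x = s * (n • s⁻¹ * x)`
with the second factor in `L`. -/
theorem exists_nsmul_mem_range_σ (hspan : (AddSubgroup.closure (M : Set R)).FiniteIndex)
    (s : (action M L hM hL).S) :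
    ∃ n : ℕ, 0 < n ∧ ∀ x, n • x ∈ ((action M L hM hL).σ s).range := by
  obtain ⟨n, hn, r, hr, e⟩ := isLarge_map_closure hspan ((s.1⁻¹ : (QR R)ˣ) : QR R)
  change ι r = _ at e
  refine ⟨n, hn, fun x => ⟨⟨ι r * x.1, closure_mul_mem hL hr x.2⟩, Subtype.ext ?_⟩⟩
  change (s.1 : QR R) * (ι r * x.1) = n • x.1
  rw [e, ← mul_assoc, mul_smul_comm, Units.mul_inv, smul_mul_assoc, one_mul]

/-- Injectivity of `1 - a` passes from `L` to `ℚR` by clearing denominators, and becomes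
surjectivity in finite dimension. -/
theorem exists_eq_sub_smul [Module.Finite ℤ R] (hreg : ∀ a ∈ M, IsLeftRegular a)
    (hrank : IsFullRank L)
    (hinj : ∃ a ∈ M, Set.InjOn (fun x => (1 - ι a) * x) (L : Set (QR R))) :
    ∃ s ∈ (action M L hM hL).S, ∀ v : QR R, ∃ w, v = w - s • w := by
  obtain ⟨a, ha, h⟩ := hinj
  obtain ⟨s, hs, e⟩ := exists_mem_units hreg ha
  have : IsAddTorsionFree (QR R) := .of_module_rat _
  have h1 : Function.Injective (LinearMap.mulLeft ℚ (1 - ι a : QR R)) := by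
    rw [injective_iff_map_eq_zero]
    intro x hx
    obtain ⟨n, hn, hnx⟩ := AddSubgroup.IsLarge.of_span_eq_top hrank x
    have h2 : n • x = 0 := h hnx L.zero_mem (by
      change (1 - ι a) * x = 0 at hx
      simp only [mul_smul_comm, hx, smul_zero, mul_zero])
    exact (nsmul_eq_zero_iff_right hn.ne').1 h2
  refine ⟨s, hs, fun v => ?_⟩
  obtain ⟨w, hw⟩ := LinearMap.injective_iff_surjective.1 h1 v
  refine ⟨w, ?_⟩
  rw [Units.smul_def, smul_eq_mul, e, ← hw, LinearMap.mulLeft_apply, sub_mul, one_mul]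

end

/-! ### Algebra isomorphisms from groupoid isomorphisms -/

variable {R₁ R₂ : Type*} [Ring R₁] [Ring R₂] {M₁ : Submonoid R₁} {M₂ : Submonoid R₂}
  {L₁ : AddSubgroup (QR R₁)} {L₂ : AddSubgroup (QR R₂)}

theorem exists_linearMap [Module.Finite ℤ R₁]
    (hreg : ∀ a ∈ M₁, IsLeftRegular a)
    (hcomm₁ : ∀ a ∈ M₁, ∀ b ∈ M₁, a * b = b * a) (hcomm₂ : ∀ a ∈ M₂, ∀ b ∈ M₂, a * b = b * a)
    (hspan : (AddSubgroup.closure (M₁ : Set R₁)).FiniteIndex)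
    (hinv₁ : ∀ a ∈ M₁, ∀ x ∈ L₁, ι a * x ∈ L₁) (hinv₂ : ∀ a ∈ M₂, ∀ x ∈ L₂, ι a * x ∈ L₂)
    (hrank : IsFullRank L₁)
    (hinj : ∃ a ∈ M₁, Set.InjOn (fun x => (1 - ι a) * x) (L₁ : Set (QR R₁)))
    (I : TopGroupoid.Iso (action M₁ L₁ hcomm₁ hinv₁).groupoid
      (action M₂ L₂ hcomm₂ hinv₂).groupoid) :
    ∃ F : QR R₁ →ₗ[ℚ] QR R₂, Function.Injective F ∧ ∀ a ∈ M₁,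
      ∃ u ∈ Subgroup.closure (units M₂ : Set (QR R₂)ˣ), ∀ x, F (ι a * x) = u * F x := by
  obtain ⟨F, hF, h⟩ := AlgAct.exists_linearMap_of_iso I
    (AddSubgroup.IsLarge.of_span_eq_top hrank) (exists_nsmul_mem_range_σ hcomm₁ hinv₁ hspan)
    (exists_eq_sub_smul hcomm₁ hinv₁ hreg hrank hinj)
  refine ⟨F, hF, fun a ha => ?_⟩
  obtain ⟨s, hs, e⟩ := exists_mem_units hreg ha
  obtain ⟨u, hu, hu'⟩ := h s hs
  exact ⟨u, hu, fun x => by rw [← e]; exact hu' x⟩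

/-- Comparing the two multipliers of `a` shows `φ (ι a) = u`, an element of `⟨M₂⟩`. It is integral
because `a` is, `R₁` being finite over `ℤ`. -/
theorem exists_algEquiv_tilde [Module.Finite ℤ R₁]
    (hspan : (AddSubgroup.closure (M₁ : Set R₁)).FiniteIndex) (F : QR R₁ ≃ₗ[ℚ] QR R₂)
    (h : ∀ a ∈ M₁, ∃ u ∈ Subgroup.closure (units M₂ : Set (QR R₂)ˣ),
      ∀ x, F (ι a * x) = u * F x) :
    ∃ φ : QR R₁ ≃ₐ[ℚ] QR R₂, ∀ a ∈ M₁, φ (ι a) ∈ tilde M₂ := by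
  obtain ⟨φ, hφ⟩ := F.exists_algEquiv (span_image_ι hspan) (by
    rintro _ ⟨a, ha, rfl⟩
    obtain ⟨u, -, hu⟩ := h a ha
    exact ⟨u, hu⟩)
  refine ⟨φ, fun a ha => ⟨?_, isIntegral_map φ (isIntegral_ι a)⟩⟩
  obtain ⟨u, hu, hu'⟩ := h a ha
  refine ⟨u, hu, ?_⟩
  have := (hu' (F.symm 1)).symm.trans (hφ _ _)
  simpa using this

/-! ### Isomorphisms of actions -/

/-- The groupoid uses elements outside `M` and `L`, so the pair `(t, b)` is first extended: `b` to a
linear bijection `E`, and `t` to the algebra isomorphism `φ` along which `E` is semilinear. These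
form an `AmbientIso`. -/
theorem ActionsIsomorphic.nonempty_iso [Module.Finite ℤ R₁]
    (hcomm₁ : ∀ a ∈ M₁, ∀ b ∈ M₁, a * b = b * a) (hcomm₂ : ∀ a ∈ M₂, ∀ b ∈ M₂, a * b = b * a)
    (hspan : (AddSubgroup.closure (M₁ : Set R₁)).FiniteIndex)
    (hinv₁ : ∀ a ∈ M₁, ∀ x ∈ L₁, ι a * x ∈ L₁) (hinv₂ : ∀ a ∈ M₂, ∀ x ∈ L₂, ι a * x ∈ L₂)
    (hrank₁ : IsFullRank L₁) (hrank₂ : IsFullRank L₂) (h : ActionsIsomorphic M₁ M₂ L₁ L₂) :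
    Nonempty (TopGroupoid.Iso (action M₁ L₁ hcomm₁ hinv₁).groupoid
      (action M₂ L₂ hcomm₂ hinv₂).groupoid) := by
  obtain ⟨t, b, htb⟩ := h
  have : IsAddTorsionFree (QR R₁) := .of_module_rat _
  have : IsAddTorsionFree (QR R₂) := .of_module_rat _
  have hlarge := AddSubgroup.IsLarge.of_span_eq_top hrank₁
  obtain ⟨F, hF⟩ := AddSubgroup.IsLarge.exists_linearMap_extension
    (i := L₁.subtype) L₁.subtype_injective (L₂.subtype.comp b.toAddMonoidHom)
  change ∀ x : L₁, F x = b x at hF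
  have hFinj : Function.Injective F := by
    rw [injective_iff_map_eq_zero]
    intro x hx
    obtain ⟨n, hn, hnx⟩ := hlarge x
    have h1 := hF ⟨n • x, hnx⟩
    rw [map_nsmul, hx, smul_zero] at h1
    have h2 : b ⟨n • x, hnx⟩ = 0 := Subtype.ext h1.symm
    rw [AddEquiv.map_eq_zero_iff] at h2
    exact (nsmul_eq_zero_iff_right hn.ne').1 (congrArg Subtype.val h2)
  have hFsurj : Function.Surjective F := by
    rw [← LinearMap.range_eq_top, eq_top_iff, ← hrank₂, Submodule.span_le]
    intro y hy
    exact ⟨b.symm ⟨y, hy⟩, by rw [hF, AddEquiv.apply_symm_apply]⟩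
  have hFmul : ∀ (a : M₁) x, F (ι (a : R₁) * x) = ι (t a : R₂) * F x := by
    intro a
    refine fun x => DFunLike.congr_fun (hlarge.eq_of_eqOn
      (f := F.toAddMonoidHom.comp (AddMonoidHom.mulLeft (ι (a : R₁))))
      (g := (AddMonoidHom.mulLeft (ι (t a : R₂))).comp F.toAddMonoidHom) ?_) x
    intro x hx
    change F (ι (a : R₁) * x) = ι (t a : R₂) * F x
    rw [hF ⟨x, hx⟩, ← htb a ⟨x, hx⟩ ⟨_, hinv₁ a a.2 x hx⟩ rfl, ← hF]
  let E := LinearEquiv.ofBijective F ⟨hFinj, hFsurj⟩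
  obtain ⟨φ, hφ⟩ := E.exists_algEquiv (span_image_ι hspan) (by
    rintro _ ⟨a, ha, rfl⟩
    exact ⟨_, hFmul ⟨a, ha⟩⟩)
  have hφt : ∀ a : M₁, φ (ι (a : R₁)) = ι (t a : R₂) := by
    intro a
    have h1 : E (ι (a : R₁) * E.symm 1) = ι (t a : R₂) * E (E.symm 1) := hFmul a _
    rw [hφ, E.apply_symm_apply, mul_one, mul_one] at h1
    exact h1
  refine ⟨AlgAct.AmbientIso.groupoidIso
    { grpEquiv := Units.mapEquiv φ.toMulEquiv
      addEquiv := E.toAddEquiv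
      map_smul := fun γ x => hφ γ x
      map_mem_S := ?_
      symm_mem_S := ?_
      map_mem_A := fun x hx => ?_
      symm_mem_A := fun x hx => ?_ }⟩
  · rintro γ ⟨a, ha, e⟩
    refine ⟨t ⟨a, ha⟩, (t ⟨a, ha⟩).2, ?_⟩
    rw [← hφt]
    exact congrArg φ e
  · rintro γ ⟨a, ha, e⟩
    obtain ⟨c, hc⟩ := t.surjective ⟨a, ha⟩
    refine ⟨c, c.2, ?_⟩
    change ι (c : R₁) = φ.symm (γ : QR R₂)
    rw [AlgEquiv.eq_symm_apply, hφt, hc]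
    exact e
  · change F x ∈ L₂
    rw [hF ⟨x, hx⟩]
    exact (b ⟨x, hx⟩).2
  · have : E.symm x = b.symm ⟨x, hx⟩ := by
      rw [LinearEquiv.symm_apply_eq]
      change _ = F _
      rw [hF, AddEquiv.apply_symm_apply]
    change E.symm x ∈ L₁
    rw [this]
    exact (b.symm ⟨x, hx⟩).2

/-- `φ` restricts to both components of the isomorphism, and multiplicativity of `φ` is the
equivariance. Injectivity of `ι` lets the map between the monoids be read inside `ℚR₂`. -/
theorem actionsIsomorphic_of_algEquiv [Module.Finite ℤ R₁] [IsAddTorsionFree R₁]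
    [Module.Finite ℤ R₂] [IsAddTorsionFree R₂] (φ : QR R₁ ≃ₐ[ℚ] QR R₂)
    (hM : ∀ a ∈ M₁, ∃ b ∈ M₂, ι b = φ (ι a)) (hM' : ∀ b ∈ M₂, ∃ a ∈ M₁, φ (ι a) = ι b)
    (hL : ∀ x ∈ L₁, φ x ∈ L₂) (hL' : ∀ y ∈ L₂, φ.symm y ∈ L₁) :
    ActionsIsomorphic M₁ M₂ L₁ L₂ := by
  have : ∀ a : M₁, ∃ b : M₂, ι (b : R₂) = φ (ι (a : R₁)) := fun a =>
    let ⟨b, hb, h⟩ := hM a a.2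
    ⟨⟨b, hb⟩, h⟩
  choose t ht using this
  let T : M₁ →* M₂ :=
    { toFun := t
      map_one' := Subtype.ext (ι_injective (by simp [ht]))
      map_mul' := fun a b => Subtype.ext (ι_injective (by simp [ht])) }
  have hT : Function.Bijective T := by
    refine ⟨fun a b h => Subtype.ext (ι_injective (φ.injective ?_)), fun b => ?_⟩
    · rw [← ht, ← ht]
      exact congrArg (fun b : M₂ => ι (b : R₂)) h
    · obtain ⟨a, ha, h⟩ := hM' b b.2
      exact ⟨⟨a, ha⟩, Subtype.ext (ι_injective ((ht _).trans h))⟩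
  refine ⟨MulEquiv.ofBijective T hT,
    { toFun := fun x => ⟨φ x, hL x x.2⟩
      invFun := fun y => ⟨φ.symm y, hL' y y.2⟩
      left_inv := fun x => Subtype.ext (φ.symm_apply_apply _)
      right_inv := fun x => Subtype.ext (φ.apply_symm_apply _)
      map_add' := fun x y => Subtype.ext (map_add φ _ _) }, fun a x y h => ?_⟩
  change φ (y : QR R₁) = ι (t a : R₂) * φ (x : QR R₁)
  rw [h, map_mul, ht]

theorem map_range_ι_of_closure_eq_top (hM : AddSubgroup.closure (M₁ : Set R₁) = ⊤)
    (φ : QR R₁ ≃ₐ[ℚ] QR R₂) (h : ∀ a ∈ M₁, φ (ι a) ∈ Set.range (ι : R₂ →+* QR R₂)) (r : R₁) :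
    φ (ι r) ∈ Set.range (ι : R₂ →+* QR R₂) := by
  have h1 : AddSubgroup.closure (M₁ : Set R₁) ≤ (ι : R₂ →+* QR R₂).range.toAddSubgroup.comap
      ((φ : QR R₁ →+* QR R₂).comp ι).toAddMonoidHom := (AddSubgroup.closure_le _).2 h
  exact h1 (hM ▸ AddSubgroup.mem_top r)

end QR
-- Rigidity of the groupoids
theorem mainTheorem12 {R₁ R₂ : Type*} [Ring R₁] [Ring R₂]
    [Module.Finite ℤ R₁] [Module.Finite ℤ R₂] [IsAddTorsionFree R₁] [IsAddTorsionFree R₂]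
    (M₁ : Submonoid R₁) (M₂ : Submonoid R₂)
    (hreg₁ : ∀ a ∈ M₁, IsLeftRegular a) (hreg₂ : ∀ a ∈ M₂, IsLeftRegular a)
    (hcomm₁ : ∀ a ∈ M₁, ∀ b ∈ M₁, a * b = b * a) (hcomm₂ : ∀ a ∈ M₂, ∀ b ∈ M₂, a * b = b * a)
    (hspan₁ : (AddSubgroup.closure (M₁ : Set R₁)).FiniteIndex)
    (hspan₂ : (AddSubgroup.closure (M₂ : Set R₂)).FiniteIndex)
    (L₁ : AddSubgroup (QR R₁)) (L₂ : AddSubgroup (QR R₂))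
    (hinv₁ : ∀ a ∈ M₁, ∀ x ∈ L₁, QR.ι a * x ∈ L₁) (hinv₂ : ∀ a ∈ M₂, ∀ x ∈ L₂, QR.ι a * x ∈ L₂)
    (hrank₁ : QR.IsFullRank L₁) (hrank₂ : QR.IsFullRank L₂)
    (hinj₁ : ∃ a ∈ M₁, Set.InjOn (fun x => (1 - QR.ι a) * x) (L₁ : Set (QR R₁)))
    (hinj₂ : ∃ a ∈ M₂, Set.InjOn (fun x => (1 - QR.ι a) * x) (L₂ : Set (QR R₂))) :
    (Nonempty (TopGroupoid.Iso (QR.action M₁ L₁ hcomm₁ hinv₁).groupoid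
        (QR.action M₂ L₂ hcomm₂ hinv₂).groupoid) →
      ∃ (φ₁ : QR R₁ ≃ₐ[ℚ] QR R₂) (φ₂ : QR R₂ ≃ₐ[ℚ] QR R₁),
        (∀ a ∈ M₁, φ₁ (QR.ι a) ∈ QR.tilde M₂) ∧ (∀ a ∈ M₂, φ₂ (QR.ι a) ∈ QR.tilde M₁)) ∧
    ((QR.ι '' (M₁ : Set R₁) = QR.tilde M₁ ∧ QR.ι '' (M₂ : Set R₂) = QR.tilde M₂) →
      (∀ ψ : QR R₁ ≃ₐ[ℚ] QR R₁,
        ψ '' (QR.ι '' (M₁ : Set R₁)) ⊆ QR.ι '' (M₁ : Set R₁) →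
          ψ '' (QR.ι '' (M₁ : Set R₁)) = QR.ι '' (M₁ : Set R₁)) →
      (((L₁ : Set (QR R₁)) = Set.range QR.ι ∧ AddSubgroup.closure (M₁ : Set R₁) = ⊤ ∧
          (L₂ : Set (QR R₂)) = Set.range QR.ι ∧ AddSubgroup.closure (M₂ : Set R₂) = ⊤) ∨
        ((L₁ : Set (QR R₁)) = QR.integers R₁ ∧ (L₂ : Set (QR R₂)) = QR.integers R₂)) →
      (QR.ActionsIsomorphic M₁ M₂ L₁ L₂ ↔
        Nonempty (TopGroupoid.Iso (QR.action M₁ L₁ hcomm₁ hinv₁).groupoid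
          (QR.action M₂ L₂ hcomm₂ hinv₂).groupoid))) := by
  have main : Nonempty (TopGroupoid.Iso (QR.action M₁ L₁ hcomm₁ hinv₁).groupoid
        (QR.action M₂ L₂ hcomm₂ hinv₂).groupoid) →
      ∃ (φ₁ : QR R₁ ≃ₐ[ℚ] QR R₂) (φ₂ : QR R₂ ≃ₐ[ℚ] QR R₁),
        (∀ a ∈ M₁, φ₁ (QR.ι a) ∈ QR.tilde M₂) ∧ (∀ a ∈ M₂, φ₂ (QR.ι a) ∈ QR.tilde M₁) := by
    rintro ⟨I⟩
    obtain ⟨F, hF, hF'⟩ := QR.exists_linearMap hreg₁ hcomm₁ hcomm₂ hspan₁ hinv₁ hinv₂ hrank₁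
      hinj₁ I
    obtain ⟨G, hG, hG'⟩ := QR.exists_linearMap hreg₂ hcomm₂ hcomm₁ hspan₂ hinv₂ hinv₁ hrank₂
      hinj₂ I.symm
    -- Injections in both directions force equal finite dimensions, so each of them is bijective.
    have hdim : Module.finrank ℚ (QR R₁) = Module.finrank ℚ (QR R₂) :=
      le_antisymm (LinearMap.finrank_le_finrank_of_injective hF)
        (LinearMap.finrank_le_finrank_of_injective hG)
    obtain ⟨φ₁, h₁⟩ := QR.exists_algEquiv_tilde hspan₁ (LinearEquiv.ofBijective F
      ⟨hF, (LinearMap.injective_iff_surjective_of_finrank_eq_finrank hdim).1 hF⟩) hF'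
    obtain ⟨φ₂, h₂⟩ := QR.exists_algEquiv_tilde hspan₂ (LinearEquiv.ofBijective G
      ⟨hG, (LinearMap.injective_iff_surjective_of_finrank_eq_finrank hdim.symm).1 hG⟩) hG'
    exact ⟨φ₁, φ₂, h₁, h₂⟩
  refine ⟨main, ?_⟩
  rintro ⟨hN₁, hN₂⟩ hS hL
  refine ⟨QR.ActionsIsomorphic.nonempty_iso hcomm₁ hcomm₂ hspan₁ hinv₁ hinv₂ hrank₁ hrank₂,
    fun hI => ?_⟩
  obtain ⟨φ₁, φ₂, h₁, h₂⟩ := main hI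
  rw [← hN₂] at h₁
  rw [← hN₁] at h₂
  -- By (N) the composite `φ₂ ∘ φ₁` maps `M₁` into itself, hence onto itself by (S). Therefore `φ₂`
  -- already maps `M₂` onto `M₁`, and its inverse is the required isomorphism.
  have hψ := hS (φ₁.trans φ₂) (by
    rintro _ ⟨_, ⟨a, ha, rfl⟩, rfl⟩
    obtain ⟨b, hb, e⟩ := h₁ a ha
    rw [AlgEquiv.trans_apply, ← e]
    exact h₂ b hb)
  have hM : ∀ a ∈ M₁, ∃ b ∈ M₂, QR.ι b = φ₂.symm (QR.ι a) := by
    intro a ha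
    obtain ⟨_, ⟨c, hc, rfl⟩, e⟩ := hψ.symm ▸ Set.mem_image_of_mem QR.ι ha
    obtain ⟨b, hb, e'⟩ := h₁ c hc
    refine ⟨b, hb, ?_⟩
    rw [AlgEquiv.eq_symm_apply, e', ← e]
    rfl
  have hM' : ∀ b ∈ M₂, ∃ a ∈ M₁, φ₂.symm (QR.ι a) = QR.ι b := by
    intro b hb
    obtain ⟨a, ha, e⟩ := h₂ b hb
    exact ⟨a, ha, by rw [e, AlgEquiv.symm_apply_apply]⟩
  have hL' : (∀ x ∈ L₁, φ₂.symm x ∈ L₂) ∧ ∀ y ∈ L₂, φ₂ y ∈ L₁ := by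
    simp only [← SetLike.mem_coe]
    -- In the first case the `L_i` are the additive spans of the matched monoids; in the second,
    -- algebra isomorphisms preserve integrality.
    obtain ⟨hL₁, hM₁, hL₂, hM₂⟩ | ⟨hL₁, hL₂⟩ := hL
    · rw [hL₁, hL₂]
      refine ⟨?_, ?_⟩
      · rintro _ ⟨r, rfl⟩
        exact QR.map_range_ι_of_closure_eq_top hM₁ φ₂.symm
          (fun a ha => let ⟨b, _, e⟩ := hM a ha; ⟨b, e⟩) r
      · rintro _ ⟨r, rfl⟩
        exact QR.map_range_ι_of_closure_eq_top hM₂ φ₂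
          (fun b hb => let ⟨a, _, e⟩ := h₂ b hb; ⟨a, e⟩) r
    · rw [hL₁, hL₂]
      exact ⟨fun x hx => QR.isIntegral_map φ₂.symm hx, fun y hy => QR.isIntegral_map φ₂ hy⟩
  exact QR.actionsIsomorphic_of_algEquiv φ₂.symm hM hM' hL'.1 hL'.2
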